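/- Let $M$ be a connected smooth manifold (Hausdorff, second countable, of finite dimension) and let $(h,W)$ be navigation data on $M$: $h$ is a smooth Riemannian metric and $W$ is a smooth vector field with $\|W\|_h<1$ everywhere. Write $\langle\cdot,\cdot\rangle$ and $\|\cdot\|$ for the inner product and norm of $h$, $\nabla^R$ for its Levi-Civita connection, with Christoffel symbols $A^k_{ij}$, and put $\lambda=1-\|W\|^2$. The Randers metric of $(h,W)$ is $$F(x,y)=\frac{\sqrt{\langle y,W\rangle^2+\lambda\|y\|^2}}{\lambda}-\frac{\langle y,W\rangle}{\lambda},$$ and its geodesics are the regular curves (with nowhere vanishing velocity, on open intervals) satisfying the Euler-Lagrange equations of the energy $\tfrac12F^2$. The natural spray of $(h,W)$ is $S=y^k\frac{\partial}{\partial x^k}-2G^k\frac{\partial}{\partial y^k}$ with $$G^k(x,y)=\tfrac12\Bigl(A^k_{ij}y^iy^j-F(x,y)\,y^iA^k_{ij}W^j-F(x,y)\,y^i\tfrac{\partial W^k}{\partial x^i}\Bigr),$$ and its geodesics are the regular curves with $\ddot x^k+2G^k(x,\dot x)=0$; equivalently, $\nabla^R_{\dot c}\dot c=F(\dot c)\,\nabla^R_{\dot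 c}W$. The geodesics of $h$ are the regular curves with $\nabla^R_{\dot c}\dot c=0$. Two families of curves are called projectively equivalent if every curve of either family becomes, after an orientation-preserving reparametrization of its whole domain, a curve of the other family. The vector field $W$ is called concircular with respect to $h$ if there is $\varphi\in C^\infty(M)$ with $\nabla^R_XW=\varphi X$ for all vector fields $X$. Then the following are equivalent: 1. the geodesics of the natural spray and the geodesics of $F$ coincide as parametrized curves; 2. the geodesics of the natural spray are projectively equivalent to the geodesics of $h$; 3. both the geodesics of the natural spray and the geodesics of $F$ are projectively equivalent to the geodesics of $h$; 4. $W$ is concircular with respect to $h$. -/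

import Mathlib

open scoped Manifold ContDiff Bundle
open Set

noncomputable section

namespace ZermeloNavigation

section Coordinates

variable (V : Type*) [NormedAddCommGroup V] [NormedSpace ℝ V] [FiniteDimensional ℝ V]

/-- The index set `{1, …, n}` of the coordinates of the model space `V ≅ ℝⁿ`. -/
abbrev Ix : Type := Fin (Module.finrank ℝ V)

variable {V}

/-- The `i`-th vector of a fixed basis of the model space `V`. The linear coordinates on `V` in this
basis turn every chart `φ : M → V` into local coordinates `(x¹, …, xⁿ)`. -/
def stdVec (i : Ix V) : V := Module.finBasis ℝ V i

/-- The `i`-th linear coordinate `yⁱ` of `y ∈ V`. -/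
def comp (y : V) (i : Ix V) : ℝ := (Module.finBasis ℝ V).repr y i

/-- The vector of `V` with coordinates `a¹, …, aⁿ`. -/
def vec (a : Ix V → ℝ) : V := ∑ i, a i • stdVec i

end Coordinates

section Manifold

variable {V : Type*} [NormedAddCommGroup V] [NormedSpace ℝ V] [FiniteDimensional ℝ V]
  {M : Type*} [TopologicalSpace M] [ChartedSpace V M]

/-- The tangent vector `yⁱ ∂/∂xⁱ` at the point of `M` with coordinates `x` in the chart `φ`. -/
def ofCoord (φ : OpenPartialHomeomorph M V) (x y : V) :
    TangentSpace 𝓘(ℝ, V) (φ.symm x) :=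
  mfderiv 𝓘(ℝ, V) 𝓘(ℝ, V) φ.symm x y

/-- The components in the chart `φ` of a tangent vector `v` at `p`. -/
def toCoord (φ : OpenPartialHomeomorph M V) (p : M) (v : TangentSpace 𝓘(ℝ, V) p) :
    V :=
  mfderiv 𝓘(ℝ, V) 𝓘(ℝ, V) φ p v

variable (V M) in
/-- Navigation data `(h, W)` on the smooth manifold `M`: a smooth Riemannian metric `h` and a
smooth vector field `W` whose `h`-length is everywhere less than `1`. -/
structure NavigationData [IsManifold 𝓘(ℝ, V) ∞ M] where
  /-- the Riemannian metric `h` -/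
  metric : Bundle.ContMDiffRiemannianMetric 𝓘(ℝ, V) ∞ V
    (fun p : M => TangentSpace 𝓘(ℝ, V) p)
  /-- the wind `W` -/
  wind : (p : M) → TangentSpace 𝓘(ℝ, V) p
  /-- `W` is smooth -/
  wind_smooth : ContMDiff 𝓘(ℝ, V) 𝓘(ℝ, V).tangent ∞
    (fun p => (⟨p, wind p⟩ : TangentBundle 𝓘(ℝ, V) M))
  /-- `‖W‖² < 1` -/
  wind_lt_one : ∀ p, metric.inner p (wind p) (wind p) < 1

namespace NavigationData

variable [IsManifold 𝓘(ℝ, V) ∞ M] (D : NavigationData V M)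

/-- The function `λ = 1 - ‖W‖²`. -/
def lam (p : M) : ℝ := 1 - D.metric.inner p (D.wind p) (D.wind p)

/-- The Randers metric
`F(p, v) = √(⟨v, W⟩² + λ ‖v‖²) / λ - ⟨v, W⟩ / λ` of the navigation data. -/
def randers (p : M) (v : TangentSpace 𝓘(ℝ, V) p) : ℝ :=
  √((D.metric.inner p v (D.wind p)) ^ 2 + D.lam p * D.metric.inner p v v) / D.lam p
    - D.metric.inner p v (D.wind p) / D.lam p

/-- The Gram matrix `h_{ij}(x)` of the Riemannian metric in the chart `φ`. -/
def gram (φ : OpenPartialHomeomorph M V) (x : V) : Matrix (Ix V) (Ix V) ℝ :=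
  Matrix.of fun i j =>
    D.metric.inner (φ.symm x) (ofCoord φ x (stdVec i)) (ofCoord φ x (stdVec j))

/-- The partial derivative `∂h_{ij}/∂x^l` in the chart `φ`. -/
def dGram (φ : OpenPartialHomeomorph M V) (x : V) (l i j : Ix V) : ℝ :=
  fderiv ℝ (fun z => D.gram φ z i j) x (stdVec l)

/-- The Christoffel symbols `A^k_{ij}` of the Levi-Civita connection of `h` in the chart `φ`:
`A^k_{ij} = ½ h^{kl} (∂_i h_{jl} + ∂_j h_{il} - ∂_l h_{ij})`. -/
def christoffel (φ : OpenPartialHomeomorph M V) (x : V) (k i j : Ix V) : ℝ :=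
  (1 / 2) * ∑ l, (D.gram φ x)⁻¹ k l *
    (D.dGram φ x i j l + D.dGram φ x j i l - D.dGram φ x l i j)

/-- The components `W^k(x)` of the wind in the chart `φ`. -/
def windCoord (φ : OpenPartialHomeomorph M V) (x : V) : V :=
  toCoord φ (φ.symm x) (D.wind (φ.symm x))

/-- The components `(∇^R_y W)^k = y^i (∂W^k/∂x^i + A^k_{ij} W^j)` in the chart `φ` of the
Levi-Civita covariant derivative of the wind in the direction `y`. -/
def covWind (φ : OpenPartialHomeomorph M V) (x y : V) : V :=
  vec fun k => ∑ i, comp y i *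
    (fderiv ℝ (fun z => comp (D.windCoord φ z) k) x (stdVec i)
      + ∑ j, D.christoffel φ x k i j * comp (D.windCoord φ x) j)

/-- The Randers metric in the chart `φ`, as a function `F(x, y)` of the induced coordinates of
the tangent bundle. -/
def randersCoord (φ : OpenPartialHomeomorph M V) (x y : V) : ℝ :=
  D.randers (φ.symm x) (ofCoord φ x y)

/-- The spray coefficients `G^k(x, y) = ½ A^k_{ij} y^i y^j` of the Riemannian metric `h`. -/
def riemannSpray (φ : OpenPartialHomeomorph M V) (x y : V) : V :=
  vec fun k => (1 / 2) * ∑ i, ∑ j, D.christoffel φ x k i j * comp y i * comp y j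

/-- The spray coefficients of the natural spray,
`G^k(x, y) = ½ (A^k_{ij} y^i y^j - F(x, y) y^i A^k_{ij} W^j - F(x, y) y^i ∂W^k/∂x^i)`. -/
def naturalSpray (φ : OpenPartialHomeomorph M V) (x y : V) : V :=
  vec fun k => (1 / 2) *
    ((∑ i, ∑ j, D.christoffel φ x k i j * comp y i * comp y j)
      - D.randersCoord φ x y * (∑ i, ∑ j, comp y i * D.christoffel φ x k i j * comp (D.windCoord φ x) j)
      - D.randersCoord φ x y *
          ∑ i, comp y i * fderiv ℝ (fun z => comp (D.windCoord φ z) k) x (stdVec i))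

/-- `W` is concircular with respect to `h`: there is `f ∈ C^∞(M)` with `∇^R_X W = f X` for every
tangent vector `X`. -/
def IsConcircular : Prop :=
  ∃ f : M → ℝ, ContMDiff 𝓘(ℝ, V) 𝓘(ℝ, ℝ) ∞ f ∧
    ∀ φ ∈ atlas V M, ∀ x ∈ φ.target, ∀ y : V,
      D.covWind φ x y = f (φ.symm x) • y

end NavigationData

variable (V) in
/-- `c` is a regular curve of class `C²` (nowhere vanishing velocity) on the open interval `J`. -/
def IsRegularCurve (J : Set ℝ) (c : ℝ → M) : Prop :=
  IsOpen J ∧ J.OrdConnected ∧ ContMDiffOn 𝓘(ℝ, ℝ) 𝓘(ℝ, V) 2 c J ∧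
    ∀ t ∈ J, mfderiv 𝓘(ℝ, ℝ) 𝓘(ℝ, V) c t 1 ≠ 0

/-- The regular curve `c : J → M` is a path of the spray
`y^k ∂/∂x^k - 2 G^k(x, y) ∂/∂y^k`, i.e. it satisfies `ẍ + 2 G(x, ẋ) = 0` in every chart `φ` of the
atlas. The spray is given by its coefficients `G φ x y` in each chart `φ`. -/
def IsSprayPath (G : OpenPartialHomeomorph M V → V → V → V)
    (J : Set ℝ) (c : ℝ → M) : Prop :=
  IsRegularCurve V J c ∧
    ∀ φ ∈ atlas V M, ∀ t ∈ J, c t ∈ φ.source →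
      HasDerivAt (deriv (φ ∘ c)) (-(2 : ℝ) • G φ (φ (c t)) (deriv (φ ∘ c) t)) t

/-- The regular curve `c : J → M` is a geodesic of the Finsler metric `F`: in every chart of the
atlas it satisfies the Euler-Lagrange equation `d/dt (∂E/∂y (x, ẋ)) = ∂E/∂x (x, ẋ)` of the energy
`E = F² / 2`. -/
def IsFinslerGeodesic (F : (p : M) → TangentSpace 𝓘(ℝ, V) p → ℝ) (J : Set ℝ) (c : ℝ → M) : Prop :=
  IsRegularCurve V J c ∧
    ∀ φ ∈ atlas V M, ∀ t ∈ J, c t ∈ φ.source →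
      let E : V → V → ℝ := fun x y => (1 / 2) * (F (φ.symm x) (ofCoord φ x y)) ^ 2
      HasDerivAt (fun s => fderiv ℝ (fun y => E (φ (c s)) y) (deriv (φ ∘ c) s))
        (fderiv ℝ (fun x => E x (deriv (φ ∘ c) t)) (φ (c t))) t

end Manifold

/-- Two families of parametrized curves (`P J c` meaning that `c : J → M` belongs to the first
one) coincide. -/
def SameGeodesics {M : Type*} (P Q : Set ℝ → (ℝ → M) → Prop) : Prop :=
  ∀ (J : Set ℝ) (c : ℝ → M), P J c ↔ Q J c

/-- Every curve `c : J → M` of the first family becomes a curve of the second one after an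
orientation-preserving reparametrization `s : J' → J` of its whole domain. -/
def ReparametrizesInto {M : Type*} (P Q : Set ℝ → (ℝ → M) → Prop) : Prop :=
  ∀ (J : Set ℝ) (c : ℝ → M), P J c → ∃ (J' : Set ℝ) (s : ℝ → ℝ), IsOpen J' ∧ J'.OrdConnected ∧
    ContDiffOn ℝ 2 s J' ∧ (∀ t ∈ J', 0 < deriv s t) ∧ s '' J' = J ∧ Q J' (c ∘ s)

/-- The two families of curves are projectively equivalent: they coincide up to
orientation-preserving reparametrization. -/
def ProjectivelyEquivalent {M : Type*} (P Q : Set ℝ → (ℝ → M) → Prop) : Prop :=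
  ReparametrizesInto P Q ∧ ReparametrizesInto Q P

namespace NavigationData

variable {V : Type*} [NormedAddCommGroup V] [NormedSpace ℝ V] [FiniteDimensional ℝ V]
  {M : Type*} [TopologicalSpace M] [ChartedSpace V M]
  [IsManifold 𝓘(ℝ, V) ∞ M] (D : NavigationData V M)

/-- The geodesics (paths) of the natural spray of `(h, W)`. -/
def IsNaturalGeodesic (J : Set ℝ) (c : ℝ → M) : Prop := IsSprayPath D.naturalSpray J c

/-- The geodesics of the Riemannian metric `h`. -/
def IsRiemannGeodesic (J : Set ℝ) (c : ℝ → M) : Prop := IsSprayPath D.riemannSpray J c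

/-- The geodesics of the Randers metric of `(h, W)`. -/
def IsRandersGeodesic (J : Set ℝ) (c : ℝ → M) : Prop := IsFinslerGeodesic D.randers J c

end NavigationData

end ZermeloNavigation

end

/-! The Randers norm is the positive solution of `λF² + 2F⟨y,W⟩ = ‖y‖²`, that is, of `‖y - F W‖ =
F`. Put `N = y - F W` and `μ = λF + ⟨y,W⟩ > 0`. Differentiating this relation implicitly
(`fderiv_randers`) gives `∂F/∂y = ⟨N,·⟩/μ`, so the momentum of `½F²` is `(F/μ)⟨N,·⟩`. With `Z = ∇_ċ
ċ - F ∇_ċ W`, which vanishes exactly on natural geodesics, the Euler-Lagrange equation becomes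
(`euler_lagrange_iff`) `(F/μ)' ⟨N,η⟩ + (F/μ) ⟨Z - F' W, η⟩ = -(F²/μ) ⟨N, ∇_η W⟩` for all `η`, where
`μF' = ⟨N,Z⟩`.

1 → 4: along a natural geodesic `Z = 0`, so `F' = 0` and the equation says that `N` is an
eigenvector of the transpose of `∇W`. Every nonzero `n` occurs as `N`, namely for `y = n + ‖n‖W`,
and local existence supplies a natural geodesic with that velocity. A transpose for which all
vectors are eigenvectors comes from a scalar map.

4 → 1: if `∇W = k·id`, the equation forces `Z - F' W = bN`; pairing with `N` and computing `μ'`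
yield `b = 0`, hence `F' = 0` and `Z = 0`. The converse is a substitution
(`euler_lagrange_iff_of_concircular`).

2 → 4: if a natural geodesic becomes a geodesic of `h` after reparametrization, then `∇_ċ ċ = F ∇_ċ
W` is a multiple of `ċ`; the initial velocity is arbitrary.

4 → 3: natural geodesics satisfy `∇_ċ ċ = Fφ ċ`. The factor is removed, or created from a geodesic
of `h`, by solving a scalar equation for the parameter over the whole interval. Randers geodesics
are natural geodesics by 4 → 1.

The analysis is done for a metric and a wind on an open set of `V`. Transition formulas carry the
equations from chart to chart. -/

noncomputable section

namespace ZermeloNavigation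

/-! ### Christoffel maps, covariant derivatives and the Randers metric on an open subset of a vector
space. -/

section LocalGeometry
set_option synthInstance.maxHeartbeats 200000

variable {V : Type*} [NormedAddCommGroup V] [NormedSpace ℝ V]

/-- A bilinear map `Γ` is the Christoffel map of the metric `g` at `x` (Koszul formula). -/
def IsChristoffel (g : V → V →L[ℝ] V →L[ℝ] ℝ) (x : V) (Γ : V → V → V) : Prop :=
  ∀ u v z, g x (Γ u v) z =
    (1 / 2) * (fderiv ℝ g x u v z + fderiv ℝ g x v u z - fderiv ℝ g x z u v)

theorem hasFDerivAt_fderiv_comp {E G : Type*} [NormedAddCommGroup E] [NormedSpace ℝ E]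
    [NormedAddCommGroup G] [NormedSpace ℝ G] {g : V → G} {f : E → V} {f' : E →L[ℝ] V} {e : E}
    (hg : DifferentiableAt ℝ g (f e)) (hf : HasFDerivAt f f' e) :
    HasFDerivAt (fun z => g (f z)) ((fderiv ℝ g (f e)).comp f') e :=
  hg.hasFDerivAt.comp e hf

/-- The derivative stays behind an existential, so that only its values on vectors enter later
computations. -/
theorem hasFDerivAt_form_apply {E : Type*} [NormedAddCommGroup E] [NormedSpace ℝ E]
    {G : E → V →L[ℝ] V →L[ℝ] ℝ} {G' : E →L[ℝ] V →L[ℝ] V →L[ℝ] ℝ} {a b : E → V}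
    {a' b' : E →L[ℝ] V} {e : E} (hG : HasFDerivAt G G' e) (ha : HasFDerivAt a a' e)
    (hb : HasFDerivAt b b' e) :
    ∃ L : E →L[ℝ] ℝ, HasFDerivAt (fun z => G z (a z) (b z)) L e ∧
      ∀ ξ, L ξ = G' ξ (a e) (b e) + G e (a' ξ) (b e) + G e (a e) (b' ξ) := by
  refine ⟨_, (hG.clm_apply ha).clm_apply hb, fun ξ => ?_⟩
  simp
  ring

theorem fderiv_form_symm {g : V → V →L[ℝ] V →L[ℝ] ℝ} {x : V} (hg : DifferentiableAt ℝ g x)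
    (hsymm : ∀ z u v, g z u v = g z v u) (ξ u v : V) :
    fderiv ℝ g x ξ u v = fderiv ℝ g x ξ v u := by
  obtain ⟨L₁, h₁, e₁⟩ := hasFDerivAt_form_apply hg.hasFDerivAt (hasFDerivAt_const u x)
    (hasFDerivAt_const v x)
  obtain ⟨L₂, h₂, e₂⟩ := hasFDerivAt_form_apply hg.hasFDerivAt (hasFDerivAt_const v x)
    (hasFDerivAt_const u x)
  have h := h₁.unique (h₂.congr_of_eventuallyEq
    (Filter.Eventually.of_forall fun z => hsymm z u v))
  have e₁ := e₁ ξ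
  have e₂ := e₂ ξ
  simp only [zero_apply, map_zero, add_zero] at e₁ e₂
  rw [← e₁, ← e₂, h]

/-- Behaviour of the derivative of a metric under a change of coordinates. -/
theorem fderiv_form_transition {g₁ g₂ : V → V →L[ℝ] V →L[ℝ] ℝ} {T : V → V} {x : V}
    (hg₂ : DifferentiableAt ℝ g₂ (T x)) (hT : ContDiffAt ℝ 2 T x)
    (h : ∀ᶠ z in nhds x, ∀ u v, g₁ z u v = g₂ (T z) (fderiv ℝ T z u) (fderiv ℝ T z v))
    (hg₁ : DifferentiableAt ℝ g₁ x) (ξ u v : V) :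
    fderiv ℝ g₁ x ξ u v =
      fderiv ℝ g₂ (T x) (fderiv ℝ T x ξ) (fderiv ℝ T x u) (fderiv ℝ T x v)
      + g₂ (T x) (fderiv ℝ (fderiv ℝ T) x ξ u) (fderiv ℝ T x v)
      + g₂ (T x) (fderiv ℝ T x u) (fderiv ℝ (fderiv ℝ T) x ξ v) := by
  have hT1 : DifferentiableAt ℝ T x := hT.differentiableAt (by norm_num)
  have hT2 : DifferentiableAt ℝ (fderiv ℝ T) x :=
    (hT.fderiv_right (m := 1) (by norm_num)).differentiableAt (by norm_num)
  have hG : HasFDerivAt (fun z => g₂ (T z)) ((fderiv ℝ g₂ (T x)).comp (fderiv ℝ T x)) x :=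
    hasFDerivAt_fderiv_comp (g := g₂) hg₂ hT1.hasFDerivAt
  have hc : ∀ u, HasFDerivAt (fun z => fderiv ℝ T z u) ((fderiv ℝ (fderiv ℝ T) x).flip u) x := by
    intro u
    simpa using hT2.hasFDerivAt.clm_apply (hasFDerivAt_const u x)
  obtain ⟨L₁, h₁, e₁⟩ := hasFDerivAt_form_apply hg₁.hasFDerivAt (hasFDerivAt_const u x)
    (hasFDerivAt_const v x)
  obtain ⟨L₂, h₂, e₂⟩ := hasFDerivAt_form_apply hG (hc u) (hc v)
  have h3 := h₁.unique (h₂.congr_of_eventuallyEq (by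
    filter_upwards [h] with z hz using hz u v))
  have e₁ := e₁ ξ
  have e₂ := e₂ ξ
  simp only [zero_apply, map_zero, add_zero] at e₁
  rw [← e₁, h3, e₂]
  simp

/-- In the Koszul formula for `g₁` the second derivatives of `T` cancel by symmetry, except for `g₂
(D²T(u,v)) (DT z)`. Since `DT` is surjective and `g₂` is definite at `T x`, the vectors themselves
agree. -/
theorem IsChristoffel.transition {g₁ g₂ : V → V →L[ℝ] V →L[ℝ] ℝ} {T : V → V} {x : V}
    {Γ₁ Γ₂ : V → V → V} (h₁ : IsChristoffel g₁ x Γ₁) (h₂ : IsChristoffel g₂ (T x) Γ₂)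
    (hg₂ : DifferentiableAt ℝ g₂ (T x)) (hT : ContDiffAt ℝ 2 T x)
    (h : ∀ᶠ z in nhds x, ∀ u v, g₁ z u v = g₂ (T z) (fderiv ℝ T z u) (fderiv ℝ T z v))
    (hg₁ : DifferentiableAt ℝ g₁ x) (hsymm : ∀ z u v, g₂ z u v = g₂ z v u)
    (hpos : ∀ v, v ≠ 0 → 0 < g₂ (T x) v v) (hsurj : Function.Surjective (fderiv ℝ T x))
    (u v : V) :
    fderiv ℝ T x (Γ₁ u v) =
      Γ₂ (fderiv ℝ T x u) (fderiv ℝ T x v) + fderiv ℝ (fderiv ℝ T) x u v := by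
  have hD : ∀ a b, fderiv ℝ (fderiv ℝ T) x a b = fderiv ℝ (fderiv ℝ T) x b a := by
    intro a b
    exact (hT.isSymmSndFDerivAt (by simp)).eq a b
  have key : ∀ z, g₂ (T x) (fderiv ℝ T x (Γ₁ u v) -
      (Γ₂ (fderiv ℝ T x u) (fderiv ℝ T x v) + fderiv ℝ (fderiv ℝ T) x u v)) z = 0 := by
    intro z'
    obtain ⟨z, rfl⟩ := hsurj z'
    have e1 := h.self_of_nhds (Γ₁ u v) z
    have e2 := h₁ u v z
    have e3 := h₂ (fderiv ℝ T x u) (fderiv ℝ T x v) (fderiv ℝ T x z)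
    rw [fderiv_form_transition hg₂ hT h hg₁, fderiv_form_transition hg₂ hT h hg₁,
      fderiv_form_transition hg₂ hT h hg₁, hD v u, hD z u, hD z v] at e2
    rw [hsymm _ (fderiv ℝ T x v) (fderiv ℝ (fderiv ℝ T) x u z)] at e2
    simp only [map_sub, map_add, sub_apply, add_apply]
    linarith
  by_contra hne
  exact (hpos _ (sub_ne_zero.2 hne)).ne' (key _)

/-- Differentiating `w₂ ∘ T = DT w₁` produces a term in `D²T`, which is absorbed by the
inhomogeneous term of the transformation law of `Γ`. -/
theorem covariantDeriv_transition {w₁ w₂ T : V → V} {x : V}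
    {Γ₁ Γ₂ : V → V → V}
    (hΓ : ∀ u v, fderiv ℝ T x (Γ₁ u v) =
      Γ₂ (fderiv ℝ T x u) (fderiv ℝ T x v) + fderiv ℝ (fderiv ℝ T) x u v)
    (hT : ContDiffAt ℝ 2 T x) (hw₁ : DifferentiableAt ℝ w₁ x)
    (hw₂ : DifferentiableAt ℝ w₂ (T x))
    (h : ∀ᶠ z in nhds x, w₂ (T z) = fderiv ℝ T z (w₁ z)) (u : V) :
    fderiv ℝ w₂ (T x) (fderiv ℝ T x u) + Γ₂ (fderiv ℝ T x u) (w₂ (T x)) =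
      fderiv ℝ T x (fderiv ℝ w₁ x u + Γ₁ u (w₁ x)) := by
  have hT1 : DifferentiableAt ℝ T x := hT.differentiableAt (by norm_num)
  have hT2 : DifferentiableAt ℝ (fderiv ℝ T) x :=
    (hT.fderiv_right (m := 1) (by norm_num)).differentiableAt (by norm_num)
  have h1 := hw₂.hasFDerivAt.comp x hT1.hasFDerivAt
  have h2 := hT2.hasFDerivAt.clm_apply hw₁.hasFDerivAt
  have h3 := h1.unique (h2.congr_of_eventuallyEq h)
  have h4 := congrArg (fun L => L u) h3
  simp at h4
  rw [h4, h.self_of_nhds, map_add, hΓ]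
  abel

/-- Local navigation data on an open subset of a vector space. -/
structure IsLocalNavigation (U : Set V) (g : V → V →L[ℝ] V →L[ℝ] ℝ) (w : V → V) : Prop where
  isOpen : IsOpen U
  smooth_metric : ContDiffOn ℝ ∞ g U
  smooth_wind : ContDiffOn ℝ ∞ w U
  symm : ∀ x u v, g x u v = g x v u
  pos : ∀ x ∈ U, ∀ v, v ≠ 0 → 0 < g x v v
  lt_one : ∀ x ∈ U, g x (w x) (w x) < 1

/-- The expression under the root in the Randers metric. -/
def randersDisc (g : V → V →L[ℝ] V →L[ℝ] ℝ) (w : V → V) (x y : V) : ℝ :=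
  (g x y (w x)) ^ 2 + (1 - g x (w x) (w x)) * g x y y

/-- The Randers metric of local navigation data. -/
def localRanders (g : V → V →L[ℝ] V →L[ℝ] ℝ) (w : V → V) (x y : V) : ℝ :=
  √(randersDisc g w x y) / (1 - g x (w x) (w x)) - g x y (w x) / (1 - g x (w x) (w x))

namespace IsLocalNavigation

variable {U : Set V} {g : V → V →L[ℝ] V →L[ℝ] ℝ} {w : V → V} (H : IsLocalNavigation U g w)
  {x y : V}
include H

theorem contDiffAt_metric (hx : x ∈ U) : ContDiffAt ℝ ∞ g x :=
  H.smooth_metric.contDiffAt (H.isOpen.mem_nhds hx)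

theorem contDiffAt_wind (hx : x ∈ U) : ContDiffAt ℝ ∞ w x :=
  H.smooth_wind.contDiffAt (H.isOpen.mem_nhds hx)

theorem differentiableAt_metric (hx : x ∈ U) : DifferentiableAt ℝ g x :=
  (H.contDiffAt_metric hx).differentiableAt (by simp)

theorem differentiableAt_wind (hx : x ∈ U) : DifferentiableAt ℝ w x :=
  (H.contDiffAt_wind hx).differentiableAt (by simp)

theorem lam_pos (hx : x ∈ U) : 0 < 1 - g x (w x) (w x) := sub_pos.2 (H.lt_one x hx)

theorem disc_pos (hx : x ∈ U) (hy : y ≠ 0) : 0 < randersDisc g w x y := by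
  have := mul_pos (H.lam_pos hx) (H.pos x hx y hy)
  unfold randersDisc
  positivity

theorem lam_mul_add (hx : x ∈ U) (y : V) :
    (1 - g x (w x) (w x)) * localRanders g w x y + g x y (w x) = √(randersDisc g w x y) := by
  have := (H.lam_pos hx).ne'
  unfold localRanders
  field_simp
  ring

theorem mu_pos (hx : x ∈ U) (hy : y ≠ 0) :
    0 < (1 - g x (w x) (w x)) * localRanders g w x y + g x y (w x) := by
  rw [H.lam_mul_add hx]
  exact Real.sqrt_pos.2 (H.disc_pos hx hy)

theorem randers_pos (hx : x ∈ U) (hy : y ≠ 0) : 0 < localRanders g w x y := by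
  have h0 := H.lam_pos hx
  have h1 : g x y (w x) < √(randersDisc g w x y) := by
    apply Real.lt_sqrt_of_sq_lt
    have := mul_pos h0 (H.pos x hx y hy)
    unfold randersDisc
    linarith
  unfold localRanders
  rw [← sub_div]
  exact div_pos (sub_pos.2 h1) h0

/-- Equivalent to `‖y - F w‖ = F`. The derivative computations rest on this relation rather than on
the square root. -/
theorem randers_quadratic (hx : x ∈ U) (hy : y ≠ 0) :
    (1 - g x (w x) (w x)) * localRanders g w x y ^ 2
      + 2 * localRanders g w x y * g x y (w x) = g x y y := by
  have h0 := H.lam_pos hx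
  have h1 := congrArg (· ^ 2) (H.lam_mul_add hx y)
  simp only [Real.sq_sqrt (H.disc_pos hx hy).le] at h1
  unfold randersDisc at h1
  apply mul_left_cancel₀ h0.ne'
  linarith

/-- The two roots of the quadratic have negative product `-‖y‖²/λ`, so only one is positive. -/
theorem randers_eq_of_quadratic (hx : x ∈ U) (hy : y ≠ 0) {a : ℝ} (ha : 0 < a)
    (h : (1 - g x (w x) (w x)) * a ^ 2 + 2 * a * g x y (w x) = g x y y) :
    localRanders g w x y = a := by
  have h0 := H.lam_pos hx
  have h1 := H.randers_quadratic hx hy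
  have h2 := H.randers_pos hx hy
  have h3 := H.pos x hx y hy
  set F := localRanders g w x y
  have h4 : (F - a) * ((1 - g x (w x) (w x)) * a * F + g x y y) = 0 := by
    linear_combination a * h1 - F * h
  rcases mul_eq_zero.1 h4 with h5 | h5
  · linarith
  · have : 0 < (1 - g x (w x) (w x)) * a * F := by positivity
    linarith

theorem contDiffAt_randers (hx : x ∈ U) (hy : y ≠ 0) :
    ContDiffAt ℝ ∞ (fun q : V × V => localRanders g w q.1 q.2) (x, y) := by
  have hg : ContDiffAt ℝ ∞ (fun q : V × V => g q.1) (x, y) :=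
    (H.contDiffAt_metric hx).comp (x, y) contDiffAt_fst
  have hw : ContDiffAt ℝ ∞ (fun q : V × V => w q.1) (x, y) :=
    (H.contDiffAt_wind hx).comp (x, y) contDiffAt_fst
  have hs : ContDiffAt ℝ ∞ (fun q : V × V => q.2) (x, y) := contDiffAt_snd
  have h1 := (hg.clm_apply hs).clm_apply hw
  have h2 := contDiffAt_const (c := (1 : ℝ)).sub ((hg.clm_apply hw).clm_apply hw)
  have h3 := (hg.clm_apply hs).clm_apply hs
  have h4 := (h1.pow 2).add (h2.mul h3)
  have h0 := (H.lam_pos hx).ne'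
  exact ((h4.sqrt (H.disc_pos hx hy).ne').div h2 h0).sub (h1.div h2 h0)

/-- The total derivative of the Randers metric. -/
theorem fderiv_randers (hx : x ∈ U) (hy : y ≠ 0) (ξ η : V) :
    ((1 - g x (w x) (w x)) * localRanders g w x y + g x y (w x)) *
      fderiv ℝ (fun q : V × V => localRanders g w q.1 q.2) (x, y) (ξ, η) =
    (1 / 2) * fderiv ℝ g x ξ (y - localRanders g w x y • w x) (y - localRanders g w x y • w x)
      + g x (y - localRanders g w x y • w x) (η - localRanders g w x y • fderiv ℝ w x ξ) := by
  have hF := ((H.contDiffAt_randers hx hy).differentiableAt (by simp)).hasFDerivAt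
  set L := fderiv ℝ (fun q : V × V => localRanders g w q.1 q.2) (x, y)
  have hg : HasFDerivAt (fun q : V × V => g q.1)
      ((fderiv ℝ g x).comp (ContinuousLinearMap.fst ℝ V V)) (x, y) :=
    hasFDerivAt_fderiv_comp (g := g) (f := Prod.fst) (e := (x, y)) (H.differentiableAt_metric hx) hasFDerivAt_fst
  have hw : HasFDerivAt (fun q : V × V => w q.1)
      ((fderiv ℝ w x).comp (ContinuousLinearMap.fst ℝ V V)) (x, y) :=
    hasFDerivAt_fderiv_comp (f := Prod.fst) (e := (x, y)) (H.differentiableAt_wind hx) hasFDerivAt_fst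
  have hs : HasFDerivAt (fun q : V × V => q.2) (ContinuousLinearMap.snd ℝ V V) (x, y) :=
    hasFDerivAt_snd
  obtain ⟨L₁, h₁, e₁⟩ := hasFDerivAt_form_apply hg hs hw
  obtain ⟨L₂, h₂, e₂⟩ := hasFDerivAt_form_apply hg hw hw
  obtain ⟨L₃, h₃, e₃⟩ := hasFDerivAt_form_apply hg hs hs
  have h4 := ((h₂.const_sub 1).mul (hF.pow 2)).add ((hF.const_mul 2).mul h₁)
  -- Smoothness of `F` is already known, so its derivative can be read off from the differentiated
  -- quadratic relation, where it appears with the factor `2μ`.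
  have hev : ∀ᶠ q : V × V in nhds (x, y), g q.1 q.2 q.2 =
      (1 - g q.1 (w q.1) (w q.1)) * localRanders g w q.1 q.2 ^ 2
      + 2 * localRanders g w q.1 q.2 * g q.1 q.2 (w q.1) := by
    filter_upwards [continuousAt_fst.eventually (H.isOpen.mem_nhds hx),
      continuousAt_snd.eventually (isOpen_ne.mem_nhds hy)] with q hq1 hq2
    exact (H.randers_quadratic hq1 hq2).symm
  have h5 := h₃.unique (h4.congr_of_eventuallyEq hev)
  have h6 := congrArg (fun L => L (ξ, η)) h5
  simp [e₁, e₂, e₃] at h6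
  have hsy := fderiv_form_symm (H.differentiableAt_metric hx) H.symm ξ
  simp only [map_sub, map_smul, sub_apply, smul_apply, smul_eq_mul]
  rw [hsy (w x) y]
  rw [H.symm x η y] at h6
  rw [H.symm x (fderiv ℝ w x ξ) (w x), H.symm x η (w x)] at h6
  linear_combination (-1/2 : ℝ) * h6

end IsLocalNavigation
end LocalGeometry

/-! ### The Euler-Lagrange equation of the Randers energy in covariant form. -/

section EulerLagrange
set_option synthInstance.maxHeartbeats 200000

variable {V : Type*} [NormedAddCommGroup V] [NormedSpace ℝ V]

theorem trilinear_sub_smul (D : V →L[ℝ] V →L[ℝ] V →L[ℝ] ℝ) (r : ℝ) (a b u v : V) :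
    D (a - r • b) u v = D a u v - r * D b u v ∧ D u (a - r • b) v = D u a v - r * D u b v ∧
      D u v (a - r • b) = D u v a - r * D u v b := by
  refine ⟨?_, ?_, ?_⟩
  · rw [map_sub, map_smul]; rfl
  · rw [map_sub, map_smul]; rfl
  · rw [map_sub, map_smul]; rfl

namespace IsLocalNavigation

variable {U : Set V} {g : V → V →L[ℝ] V →L[ℝ] ℝ} {w : V → V} (H : IsLocalNavigation U g w)
  {x y : V}
include H

/-- The momentum is a multiple of `⟨N,·⟩`; this is how the vector `N = y - F w` enters the
Euler-Lagrange equation. -/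
theorem fderiv_energy_velocity (hx : x ∈ U) (hy : y ≠ 0) :
    fderiv ℝ (fun y => (1 / 2) * localRanders g w x y ^ 2) y =
      (localRanders g w x y /
        ((1 - g x (w x) (w x)) * localRanders g w x y + g x y (w x))) •
        g x (y - localRanders g w x y • w x) := by
  have hF := ((H.contDiffAt_randers hx hy).differentiableAt (by simp)).hasFDerivAt
  have h1 : HasFDerivAt (fun y => localRanders g w x y) _ y :=
    hF.comp (f := fun y => (x, y)) y (hasFDerivAt_prodMk_right x y)
  have h2 := ((h1.pow 2).const_mul (1 / 2 : ℝ)).fderiv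
  rw [h2]
  ext η
  have h3 := H.fderiv_randers hx hy 0 η
  have h4 := (H.mu_pos hx hy).ne'
  simp only [map_zero, zero_apply, mul_zero, smul_zero, sub_zero, zero_add] at h3
  generalize (1 - g x (w x) (w x)) * localRanders g w x y + g x y (w x) = m at h3 h4 ⊢
  simp only [smul_apply, smul_eq_mul, ← h3]
  simp
  field_simp

theorem fderiv_energy_position (hx : x ∈ U) (hy : y ≠ 0) (ξ : V) :
    fderiv ℝ (fun x => (1 / 2) * localRanders g w x y ^ 2) x ξ =
      (localRanders g w x y /
        ((1 - g x (w x) (w x)) * localRanders g w x y + g x y (w x))) *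
        ((1 / 2) * fderiv ℝ g x ξ (y - localRanders g w x y • w x)
            (y - localRanders g w x y • w x)
          - localRanders g w x y *
            g x (y - localRanders g w x y • w x) (fderiv ℝ w x ξ)) := by
  have hF := ((H.contDiffAt_randers hx hy).differentiableAt (by simp)).hasFDerivAt
  have h1 : HasFDerivAt (fun x => localRanders g w x y) _ x :=
    hF.comp (f := fun x => (x, y)) x (hasFDerivAt_prodMk_left x y)
  have h2 := ((h1.pow 2).const_mul (1 / 2 : ℝ)).fderiv
  rw [h2]
  have h3 := H.fderiv_randers hx hy ξ 0
  have h4 := (H.mu_pos hx hy).ne'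
  have h5 : ∀ A B : ℝ, ((1 - g x (w x) (w x)) * localRanders g w x y + g x y (w x)) * A = B →
      A = B / ((1 - g x (w x) (w x)) * localRanders g w x y + g x y (w x)) := by
    intro A B hAB
    rw [← hAB]
    field_simp
  have h6 := h5 _ _ h3
  simp only [zero_sub, map_neg, map_smul, smul_eq_mul] at h6
  simp only [smul_apply, ContinuousLinearMap.comp_apply, ContinuousLinearMap.inl_apply,
    smul_eq_mul, nsmul_eq_mul]
  rw [h6]
  simp
  field_simp
  ring

set_option maxHeartbeats 600000 in
/-- The Euler-Lagrange equation of the Randers energy along a curve, in covariant form. -/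
theorem euler_lagrange_iff {c v : ℝ → V} {t : ℝ} {a : V} (hx : c t ∈ U) (hy : v t ≠ 0)
    (hc : HasDerivAt c (v t) t) (hv : HasDerivAt v a t) {Γ : V → V → V}
    (hΓ : IsChristoffel g (c t) Γ) {F μ : ℝ} {Nv Z : V} {cov : V → V}
    (hF : F = localRanders g w (c t) (v t))
    (hμ : μ = (1 - g (c t) (w (c t)) (w (c t))) * F + g (c t) (v t) (w (c t)))
    (hN : Nv = v t - F • w (c t))
    (hcov : ∀ u, cov u = fderiv ℝ w (c t) u + Γ u (w (c t)))
    (hZ : Z = a + Γ (v t) (v t) - F • cov (v t)) :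
    ∃ f' μ' : ℝ, μ * f' = g (c t) Nv Z ∧
      μ' = -2 * g (c t) (cov (v t)) (w (c t)) * F
        + (1 - g (c t) (w (c t)) (w (c t))) * f'
        + g (c t) (a + Γ (v t) (v t)) (w (c t)) + g (c t) (v t) (cov (v t)) ∧
      (HasDerivAt (fun s => fderiv ℝ (fun y => (1 / 2) * localRanders g w (c s) y ^ 2) (v s))
        (fderiv ℝ (fun x => (1 / 2) * localRanders g w x (v t) ^ 2) (c t)) t ↔
        ∀ η, (f' * μ - F * μ') / μ ^ 2 * g (c t) Nv η + F / μ * g (c t) (Z - f' • w (c t)) η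
          = - (F ^ 2 / μ) * g (c t) Nv (cov η)) := by
  have hμ0 : μ ≠ 0 := by rw [hμ, hF]; exact (H.mu_pos hx hy).ne'
  have hFd := ((H.contDiffAt_randers hx hy).differentiableAt (by simp)).hasFDerivAt
  have hFt : HasDerivAt (fun s => localRanders g w (c s) (v s)) _ t :=
    hFd.comp_hasDerivAt (f := fun s => (c s, v s)) t (hc.prodMk hv)
  have hFr := H.fderiv_randers hx hy (v t) a
  set f' := fderiv ℝ (fun q : V × V => localRanders g w q.1 q.2) (c t, v t) (v t, a) with hf'
  rw [← hF, ← hμ, ← hN] at hFr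
  have hgd := H.differentiableAt_metric hx
  have hg : HasDerivAt (fun s => g (c s)) (fderiv ℝ g (c t) (v t)) t :=
    hgd.hasFDerivAt.comp_hasDerivAt (l := g) t hc
  have hw : HasDerivAt (fun s => w (c s)) (fderiv ℝ w (c t) (v t)) t :=
    (H.differentiableAt_wind hx).hasFDerivAt.comp_hasDerivAt t hc
  have hgs := fderiv_form_symm hgd H.symm
  have hww := (hg.clm_apply hw).clm_apply hw
  have hvw := (hg.clm_apply hv).clm_apply hw
  -- `M` is the derivative of `μ` along the curve, in ordinary derivatives; the second conclusion
  -- rewrites it with the covariant derivative.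
  obtain ⟨M, hM⟩ : ∃ M, M = -(2 * g (c t) (fderiv ℝ w (c t) (v t)) (w (c t))
        + fderiv ℝ g (c t) (v t) (w (c t)) (w (c t))) * F
      + (1 - g (c t) (w (c t)) (w (c t))) * f'
      + (fderiv ℝ g (c t) (v t) (v t) (w (c t)) + g (c t) a (w (c t))
        + g (c t) (v t) (fderiv ℝ w (c t) (v t))) := ⟨_, rfl⟩
  have hFt' : HasDerivAt (fun s => localRanders g w (c s) (v s)) f' t := hFt
  have hmu : HasDerivAt (fun s => (1 - g (c s) (w (c s)) (w (c s))) *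
      localRanders g w (c s) (v s) + g (c s) (v s) (w (c s))) M t := by
    refine (((hww.const_sub 1).mul hFt').add hvw).congr_deriv ?_
    rw [hM, ← hF]
    simp only [add_apply]
    rw [H.symm _ (w (c t)) (fderiv ℝ w (c t) (v t))]
    ring
  have hp : HasDerivAt (fun s => (localRanders g w (c s) (v s) /
      ((1 - g (c s) (w (c s)) (w (c s))) * localRanders g w (c s) (v s)
        + g (c s) (v s) (w (c s)))) • g (c s) (v s - localRanders g w (c s) (v s) • w (c s)))
      ((F / μ) • (fderiv ℝ g (c t) (v t) Nv + g (c t) (a - (F • fderiv ℝ w (c t) (v t)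
        + f' • w (c t)))) + ((f' * μ - F * M) / μ ^ 2) • g (c t) Nv) t := by
    have hNt := hv.sub (hFt'.smul hw)
    rw [hN, hμ, hF]
    exact (hFt'.div hmu (by rw [← hF, ← hμ]; exact hμ0)).smul (hg.clm_apply hNt)
  -- The left side is the Koszul expression for `Γ(v, N)`. Linearity of `Γ` is not assumed, so `N =
  -- v - F w` is split inside the derivative of `g`.
  have hK : ∀ z, (1 / 2) * (fderiv ℝ g (c t) (v t) Nv z + fderiv ℝ g (c t) Nv (v t) z
      - fderiv ℝ g (c t) z (v t) Nv)
      = g (c t) (Γ (v t) (v t)) z - F * g (c t) (Γ (v t) (w (c t))) z := by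
    intro z
    rw [hΓ, hΓ, hN]
    simp only [map_sub, map_smul, sub_apply, smul_apply, smul_eq_mul]
    ring
  have hcovg : ∀ u z, g (c t) (cov u) z = g (c t) (fderiv ℝ w (c t) u) z
      + g (c t) (Γ u (w (c t))) z := by
    intro u z
    rw [hcov, map_add, add_apply]
  have hZg : ∀ z, g (c t) Z z = g (c t) a z + g (c t) (Γ (v t) (v t)) z
      - F * (g (c t) (fderiv ℝ w (c t) (v t)) z + g (c t) (Γ (v t) (w (c t))) z) := by
    intro z
    rw [hZ]
    simp only [map_sub, map_add, map_smul, sub_apply, add_apply, smul_apply, smul_eq_mul, hcovg]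
  refine ⟨f', M, ?_, ?_, ?_⟩
  · rw [hFr, H.symm _ Nv Z, hZg, H.symm _ Nv]
    have e1 := hK Nv
    simp only [map_sub, map_smul, sub_apply, smul_apply, smul_eq_mul]
    linear_combination e1
  · have e1 := hΓ (v t) (w (c t)) (w (c t))
    have e2 := hΓ (v t) (v t) (w (c t))
    have e3 := hΓ (v t) (w (c t)) (v t)
    have e4 := hgs (v t) (w (c t)) (v t)
    rw [H.symm _ (v t) (cov (v t)), hcovg, hcovg, hM,
      H.symm _ (v t) (fderiv ℝ w (c t) (v t)), map_add, add_apply]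
    linear_combination 2 * F * e1 - e2 - e3 - (1 / 2) * e4
  · have hev : (fun s => fderiv ℝ (fun y => (1 / 2) * localRanders g w (c s) y ^ 2) (v s))
        =ᶠ[nhds t] fun s => (localRanders g w (c s) (v s) /
      ((1 - g (c s) (w (c s)) (w (c s))) * localRanders g w (c s) (v s)
        + g (c s) (v s) (w (c s)))) • g (c s) (v s - localRanders g w (c s) (v s) • w (c s)) := by
      filter_upwards [hc.continuousAt.eventually (H.isOpen.mem_nhds hx),
        hv.continuousAt.eventually (isOpen_ne.mem_nhds hy)] with s hs1 hs2
      exact H.fderiv_energy_velocity hs1 hs2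
    have hP := hp.congr_of_eventuallyEq hev
    have hiff : ∀ Q, HasDerivAt (fun s => fderiv ℝ
        (fun y => (1 / 2) * localRanders g w (c s) y ^ 2) (v s)) Q t ↔ _ = Q :=
      fun Q => ⟨fun h => hP.unique h, fun h => h ▸ hP⟩
    rw [hiff, ContinuousLinearMap.ext_iff]
    refine forall_congr' fun η => ?_
    have e1 := hK η
    have e2 := hΓ η (w (c t)) Nv
    have e3 := (trilinear_sub_smul (fderiv ℝ g (c t)) F (v t) (w (c t)) η Nv).2.1
    have e4 := (trilinear_sub_smul (fderiv ℝ g (c t)) F (v t) (w (c t)) Nv η).1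
    have e5 := (trilinear_sub_smul (fderiv ℝ g (c t)) F (v t) (w (c t)) Nv η).2.2
    rw [← hN] at e3 e4 e5
    -- Metric compatibility: both sides equal `⟨Γ(η, v), N⟩`. This turns the derivatives of `g` in
    -- the Euler-Lagrange equation into Christoffel terms.
    have key : fderiv ℝ g (c t) (v t) Nv η - (g (c t) (Γ (v t) (v t)) η
        - F * g (c t) (Γ (v t) (w (c t))) η)
        = (1 / 2) * fderiv ℝ g (c t) η Nv Nv + F * g (c t) (Γ η (w (c t))) Nv := by
      rw [← e1, e2, e3]
      have s1 := hgs Nv Nv η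
      have s2 := hgs Nv (v t) η
      have s3 := hgs (w (c t)) Nv η
      linear_combination (-1 / 2) * e4 + (1 / 2) * e5 + (1 / 2) * s1 - (1 / 2) * s2
        + (F / 2) * s3
    rw [H.fderiv_energy_position hx hy, ← hF, ← hμ, ← hN]
    simp only [map_sub, map_add, map_smul, sub_apply, add_apply, smul_apply, smul_eq_mul]
    rw [H.symm _ Nv (cov η), hcovg, hZg, H.symm _ Nv (fderiv ℝ w (c t) η)]
    constructor <;> intro h
    · linear_combination h - (F / μ) * key
    · linear_combination h + (F / μ) * key

end IsLocalNavigation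
end EulerLagrange

/-! ### Pointwise linear algebra and the two local implications between geodesics and
concircularity. -/

section Concircular
set_option linter.unusedSimpArgs false
set_option synthInstance.maxHeartbeats 200000

variable {V : Type*} [NormedAddCommGroup V] [NormedSpace ℝ V]

/-- Two independent eigenvectors have the same eigenvalue because their sum is an eigenvector too.
-/
theorem exists_smul_of_forall_exists_smul (A : V →ₗ[ℝ] V) (h : ∀ v, ∃ k : ℝ, A v = k • v) :
    ∃ k : ℝ, ∀ v, A v = k • v := by
  by_cases h0 : ∃ v : V, v ≠ 0
  · obtain ⟨v₀, hv₀⟩ := h0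
    obtain ⟨k₀, hk₀⟩ := h v₀
    refine ⟨k₀, fun v => ?_⟩
    by_cases hr : ∃ r : ℝ, v = r • v₀
    · obtain ⟨r, rfl⟩ := hr
      rw [map_smul, hk₀, smul_comm]
    · obtain ⟨k, hk⟩ := h v
      obtain ⟨k', hk'⟩ := h (v + v₀)
      rw [map_add, hk, hk₀, smul_add] at hk'
      have h1 : (k - k') • v = (k' - k₀) • v₀ := by
        rw [sub_smul, sub_smul, sub_eq_sub_iff_add_eq_add, hk']
        abel
      have h2 : k - k' = 0 := by
        by_contra hne
        refine hr ⟨(k - k')⁻¹ * (k' - k₀), ?_⟩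
        rw [mul_smul, ← h1, smul_smul, inv_mul_cancel₀ hne, one_smul]
      have h3 : k' - k₀ = 0 := by
        rw [h2, zero_smul] at h1
        exact (smul_eq_zero.1 h1.symm).resolve_right hv₀
      rw [hk, show k = k₀ by linarith]
  · push Not at h0
    exact ⟨0, fun v => by rw [h0 v, map_zero, smul_zero]⟩

/-- The hypothesis says that every `n` is an eigenvector of the transpose of `A`. For `n` the part
of `A v` orthogonal to `v` it gives `b n (A v) = 0`, hence `b n n = 0` and `n = 0`. -/
theorem exists_smul_of_forall_exists_form {b : V →L[ℝ] V →L[ℝ] ℝ}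
    (hpos : ∀ v, v ≠ 0 → 0 < b v v) {A : V → V}
    (h : ∀ n, n ≠ 0 → ∃ k : ℝ, ∀ v, b n (A v) = k * b n v) (v : V) : ∃ k : ℝ, A v = k • v := by
  by_cases hv : v = 0
  · refine ⟨0, ?_⟩
    by_contra hA
    rw [zero_smul] at hA
    obtain ⟨k, hk⟩ := h _ hA
    have := hpos _ hA
    rw [hk, hv, map_zero] at this
    simp at this
  refine ⟨b (A v) v / b v v, ?_⟩
  have hvv := hpos v hv
  by_contra hne
  have hn : A v - (b (A v) v / b v v) • v ≠ 0 := sub_ne_zero.2 hne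
  obtain ⟨k, hk⟩ := h _ hn
  have h1 : b (A v - (b (A v) v / b v v) • v) v = 0 := by
    simp only [map_sub, map_smul, sub_apply, smul_apply, smul_eq_mul]
    field_simp
    ring
  have h2 := hk v
  rw [h1, mul_zero] at h2
  have h3 := hpos _ hn
  rw [map_sub, h2, map_smul, h1] at h3
  simp at h3

namespace IsLocalNavigation

variable {U : Set V} {g : V → V →L[ℝ] V →L[ℝ] ℝ} {w : V → V} (H : IsLocalNavigation U g w)
  {x y : V}
include H

theorem eq_of_form_eq (hx : x ∈ U) {u v : V} (h : ∀ z, g x u z = g x v z) : u = v := by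
  by_contra hne
  have h1 := H.pos x hx (u - v) (sub_ne_zero.2 hne)
  rw [map_sub (g x), sub_apply, h, sub_self] at h1
  exact lt_irrefl _ h1

theorem euler_lagrange_iff_of_concircular {c v : ℝ → V} {t : ℝ} {a : V} (hx : c t ∈ U)
    (hy : v t ≠ 0) (hc : HasDerivAt c (v t) t) (hv : HasDerivAt v a t) {Γ : V → V → V}
    (hΓ : IsChristoffel g (c t) Γ) {k : ℝ}
    (hk : ∀ u, fderiv ℝ w (c t) u + Γ u (w (c t)) = k • u) :
    HasDerivAt (fun s => fderiv ℝ (fun y => (1 / 2) * localRanders g w (c s) y ^ 2) (v s))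
      (fderiv ℝ (fun x => (1 / 2) * localRanders g w x (v t) ^ 2) (c t)) t ↔
      a + Γ (v t) (v t) = (localRanders g w (c t) (v t) * k) • v t := by
  obtain ⟨f', μ', h1, h2, h3⟩ := H.euler_lagrange_iff hx hy hc hv hΓ rfl rfl rfl
    (fun u => rfl) rfl
  rw [h3]
  clear h3
  simp only [hk] at h1 h2 ⊢
  have hF := H.randers_pos hx hy
  have hμ := H.mu_pos hx hy
  have hq := H.randers_quadratic hx hy
  set F := localRanders g w (c t) (v t)
  set μ := (1 - g (c t) (w (c t)) (w (c t))) * F + g (c t) (v t) (w (c t)) with hμd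
  obtain ⟨Z, hZ⟩ : ∃ Z, Z = a + Γ (v t) (v t) - F • k • v t := ⟨_, rfl⟩
  rw [show a + Γ (v t) (v t) = Z + (F * k) • v t by rw [hZ, smul_smul]; abel] at h2 ⊢
  rw [← hZ] at h1
  rw [smul_smul, add_sub_cancel_right]
  have hb : g (c t) (w (c t)) (v t) = g (c t) (v t) (w (c t)) := H.symm _ _ _
  simp only [map_sub, map_add, map_smul, sub_apply, add_apply, smul_apply, smul_eq_mul, hb]
    at h1 h2 ⊢
  rw [add_eq_right]
  constructor
  · intro h
    -- The coefficient dictated by the Euler-Lagrange equation when it is solved for `Z - f' w`.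
    obtain ⟨b, hbd⟩ : ∃ b, b = - (μ / F) * ((f' * μ - F * μ') / μ ^ 2 + F ^ 2 * k / μ) := ⟨_, rfl⟩
    have hZ1 : Z = f' • w (c t) + b • (v t - F • w (c t)) := by
      apply H.eq_of_form_eq hx
      intro z
      have := h z
      simp only [map_sub, map_add, map_smul, sub_apply, add_apply, smul_apply, smul_eq_mul]
      rw [hbd]
      field_simp at this ⊢
      linarith
    -- Pair `Z = f' w + b N` with `N`: `μ f' = f' ⟨N,w⟩ + b F²`, and `μ - ⟨N,w⟩ = F`.
    have hf : f' = b * F := by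
      rw [hZ1] at h1
      simp only [map_sub, map_add, map_smul, sub_apply, add_apply, smul_apply, smul_eq_mul, hb]
        at h1
      apply mul_left_cancel₀ hF.ne'
      rw [hμd] at h1
      linear_combination h1 - b * hq
    have hm : μ' = k * F * μ + b * μ := by
      rw [hZ1] at h2
      simp only [map_sub, map_add, map_smul, sub_apply, add_apply, smul_apply, smul_eq_mul, hb]
        at h2
      rw [h2, hμd]
      linear_combination hf - k * hq
    -- With these values of `f'` and `μ'` the terms in `b` cancel on the right of its defining
    -- equation, and the terms in `k` cancel as well.
    have hb0 : b = 0 := by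
      rw [hbd, hm, hf]
      field_simp
      ring
    rw [hZ1, hf, hb0]
    simp
  · intro h η
    rw [h] at h1 h2 ⊢
    simp only [map_zero, zero_apply, mul_zero, sub_zero] at h1 h2 ⊢
    have hf : f' = 0 := by simpa [hμ.ne'] using h1
    have hm : μ' = k * F * μ := by
      rw [h2, hf, hμd]
      linear_combination (-k) * hq
    rw [hf, hm]
    field_simp
    ring

/-- On a natural geodesic `Z = 0`, hence `f' = 0`, and what remains of the Euler-Lagrange equation
is proportionality of `⟨N, ∇_η W⟩` and `⟨N, η⟩`. -/
theorem exists_eigen_of_euler_lagrange {c v : ℝ → V} {t : ℝ} {a : V} (hx : c t ∈ U)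
    (hy : v t ≠ 0) (hc : HasDerivAt c (v t) t) (hv : HasDerivAt v a t) {Γ : V → V → V}
    (hΓ : IsChristoffel g (c t) Γ)
    (ha : a + Γ (v t) (v t) = localRanders g w (c t) (v t) •
      (fderiv ℝ w (c t) (v t) + Γ (v t) (w (c t))))
    (h : HasDerivAt (fun s => fderiv ℝ (fun y => (1 / 2) * localRanders g w (c s) y ^ 2) (v s))
      (fderiv ℝ (fun x => (1 / 2) * localRanders g w x (v t) ^ 2) (c t)) t) :
    ∃ k : ℝ, ∀ u, g (c t) (v t - localRanders g w (c t) (v t) • w (c t))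
      (fderiv ℝ w (c t) u + Γ u (w (c t))) =
        k * g (c t) (v t - localRanders g w (c t) (v t) • w (c t)) u := by
  obtain ⟨f', μ', h1, h2, h3⟩ := H.euler_lagrange_iff hx hy hc hv hΓ rfl rfl rfl
    (fun u => rfl) rfl
  rw [h3] at h
  have hF := H.randers_pos hx hy
  have hμ := H.mu_pos hx hy
  rw [sub_eq_zero.2 ha] at h1 h
  rw [map_zero, mul_eq_zero, or_iff_right hμ.ne'] at h1
  set F := localRanders g w (c t) (v t)
  set μ := (1 - g (c t) (w (c t)) (w (c t))) * F + g (c t) (v t) (w (c t)) with hμd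
  refine ⟨-(μ / F ^ 2) * ((f' * μ - F * μ') / μ ^ 2), fun u => ?_⟩
  have h4 := h u
  rw [h1, zero_smul, sub_zero, map_zero, zero_apply, mul_zero, add_zero, ← h1] at h4
  rw [mul_assoc, h4]
  field_simp

end IsLocalNavigation
end Concircular

/-! ### Navigation data read in a chart, and change of charts. -/

section Chart
set_option linter.unusedSectionVars false

variable {V : Type*} [NormedAddCommGroup V] [NormedSpace ℝ V] [FiniteDimensional ℝ V]
  {M : Type*} [TopologicalSpace M] [ChartedSpace V M] [IsManifold 𝓘(ℝ, V) ∞ M]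

theorem contMDiffOn_symm {φ : OpenPartialHomeomorph M V} (hφ : φ ∈ atlas V M) :
    ContMDiffOn 𝓘(ℝ, V) 𝓘(ℝ, V) ∞ φ.symm φ.target :=
  contMDiffOn_symm_of_mem_maximalAtlas (IsManifold.subset_maximalAtlas hφ)

theorem contMDiffOn_chart' {φ : OpenPartialHomeomorph M V} (hφ : φ ∈ atlas V M) :
    ContMDiffOn 𝓘(ℝ, V) 𝓘(ℝ, V) ∞ φ φ.source :=
  contMDiffOn_of_mem_maximalAtlas (IsManifold.subset_maximalAtlas hφ)

/-- A coordinate field is the tangent map of `φ.symm` applied to a constant field on `V`. -/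
theorem contMDiffOn_ofCoord {φ : OpenPartialHomeomorph M V} (hφ : φ ∈ atlas V M) (y : V) :
    ContMDiffOn 𝓘(ℝ, V) 𝓘(ℝ, V).tangent ∞
      (fun x => (⟨φ.symm x, ofCoord φ x y⟩ : TangentBundle 𝓘(ℝ, V) M)) φ.target := by
  have h := (contMDiffOn_symm hφ).contMDiffOn_tangentMapWithin (m := ∞) (by simp)
    φ.open_target.uniqueMDiffOn
  have h2 : ContMDiffOn 𝓘(ℝ, V) 𝓘(ℝ, V).tangent ∞
      (fun x => (⟨x, y⟩ : TangentBundle 𝓘(ℝ, V) V)) φ.target := by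
    apply ContMDiff.contMDiffOn
    exact contMDiff_vectorSpace_iff_contDiff (V := fun _ => y) |>.2 contDiff_const
  refine (h.comp h2 (fun x hx => hx)).congr ?_
  intro x hx
  simp only [Function.comp, tangentMapWithin, ofCoord]
  rw [mfderivWithin_of_isOpen φ.open_target hx]

variable (D : NavigationData V M)

/-- The coordinate expression of the metric in a chart, as a bilinear form on the model space. -/
def NavigationData.metricCoord (φ : OpenPartialHomeomorph M V) (x : V) : V →L[ℝ] V →L[ℝ] ℝ :=
  ContinuousLinearMap.bilinearComp (E := V) (F := V)
    (show V →L[ℝ] V →L[ℝ] ℝ from D.metric.inner (φ.symm x))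
    (show V →L[ℝ] V from mfderiv 𝓘(ℝ, V) 𝓘(ℝ, V) φ.symm x)
    (show V →L[ℝ] V from mfderiv 𝓘(ℝ, V) 𝓘(ℝ, V) φ.symm x)

theorem NavigationData.metricCoord_apply (φ : OpenPartialHomeomorph M V) (x u v : V) :
    D.metricCoord φ x u v = D.metric.inner (φ.symm x) (ofCoord φ x u) (ofCoord φ x v) := rfl

theorem NavigationData.contDiffOn_metricCoord {φ : OpenPartialHomeomorph M V}
    (hφ : φ ∈ atlas V M) : ContDiffOn ℝ ∞ (D.metricCoord φ) φ.target := by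
  rw [contDiffOn_clm_apply]
  intro u
  rw [contDiffOn_clm_apply]
  intro v
  rw [← contMDiffOn_iff_contDiffOn]
  have h := ContMDiffOn.clm_bundle_apply₂ (n := ∞) (s := φ.target)
    (IB := 𝓘(ℝ, V)) (IM := 𝓘(ℝ, V)) (F₁ := V) (F₂ := V) (F₃ := ℝ) (B := M)
    (E₁ := fun p : M => TangentSpace 𝓘(ℝ, V) p) (E₂ := fun p : M => TangentSpace 𝓘(ℝ, V) p)
    (E₃ := Bundle.Trivial M ℝ) (b := φ.symm)
    (ψ := fun x => D.metric.inner (φ.symm x)) (v := fun x => ofCoord φ x u)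
    (w := fun x => ofCoord φ x v)
    (D.metric.contMDiff.comp_contMDiffOn (contMDiffOn_symm hφ))
    (contMDiffOn_ofCoord hφ u) (contMDiffOn_ofCoord hφ v)
  intro x hx
  have := h x hx
  simp only [Bundle.contMDiffWithinAt_totalSpace] at this
  exact this.2

theorem NavigationData.contDiffOn_windCoord {φ : OpenPartialHomeomorph M V}
    (hφ : φ ∈ atlas V M) : ContDiffOn ℝ ∞ (D.windCoord φ) φ.target := by
  have h := (contMDiffOn_chart' hφ).contMDiffOn_tangentMapWithin (m := ∞) (by simp)
    φ.open_source.uniqueMDiffOn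
  have h2 := h.comp (D.wind_smooth.comp_contMDiffOn (contMDiffOn_symm hφ))
    (fun x hx => φ.map_target hx)
  have h3 := (contMDiff_snd_tangentBundle_modelSpace V 𝓘(ℝ, V) (n := ∞)).comp_contMDiffOn h2
  rw [← contMDiffOn_iff_contDiffOn]
  refine h3.congr ?_
  intro x hx
  simp only [Function.comp, tangentMapWithin, windCoord, toCoord]
  rw [mfderivWithin_of_isOpen φ.open_source (φ.map_target hx)]

theorem NavigationData.metricCoord_symm (φ : OpenPartialHomeomorph M V) (x u v : V) :
    D.metricCoord φ x u v = D.metricCoord φ x v u := by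
  rw [D.metricCoord_apply, D.metricCoord_apply, D.metric.symm]

theorem toCoord_ofCoord {φ : OpenPartialHomeomorph M V} (hφ : φ ∈ atlas V M) {x : V}
    (hx : x ∈ φ.target) (y : V) : toCoord φ (φ.symm x) (ofCoord φ x y) = y := by
  have h := (mdifferentiable_of_mem_atlas (I := 𝓘(ℝ, V)) hφ).comp_symm_deriv hx
  exact congrArg (fun L : V →L[ℝ] V => L y) h

theorem ofCoord_toCoord {φ : OpenPartialHomeomorph M V} (hφ : φ ∈ atlas V M) {x : V}
    (hx : x ∈ φ.target) (v : TangentSpace 𝓘(ℝ, V) (φ.symm x)) :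
    ofCoord φ x (toCoord φ (φ.symm x) v) = v := by
  have h := (mdifferentiable_of_mem_atlas (I := 𝓘(ℝ, V)) hφ).symm_comp_deriv (φ.map_target hx)
  have h2 := congrArg (fun L => L v) h
  simp only [ContinuousLinearMap.comp_apply] at h2
  rw [φ.right_inv hx] at h2
  exact h2

theorem toCoord_zero (φ : OpenPartialHomeomorph M V) (p : M) : toCoord φ p 0 = 0 :=
  map_zero (mfderiv 𝓘(ℝ, V) 𝓘(ℝ, V) φ p)

theorem NavigationData.isLocalNavigation {φ : OpenPartialHomeomorph M V} (hφ : φ ∈ atlas V M) :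
    IsLocalNavigation φ.target (D.metricCoord φ) (D.windCoord φ) where
  isOpen := φ.open_target
  smooth_metric := D.contDiffOn_metricCoord hφ
  smooth_wind := D.contDiffOn_windCoord hφ
  symm := D.metricCoord_symm φ
  pos x hx v hv := by
    rw [D.metricCoord_apply]
    refine D.metric.pos _ _ fun h => hv ?_
    rw [← toCoord_ofCoord hφ hx v, h, toCoord_zero]
  lt_one x hx := by
    rw [D.metricCoord_apply, windCoord, ofCoord_toCoord hφ hx]
    exact D.wind_lt_one _

theorem NavigationData.randersCoord_eq {φ : OpenPartialHomeomorph M V} (hφ : φ ∈ atlas V M)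
    {x : V} (hx : x ∈ φ.target) (y : V) :
    D.randersCoord φ x y = localRanders (D.metricCoord φ) (D.windCoord φ) x y := by
  have hw : ofCoord φ x (D.windCoord φ x) = D.wind (φ.symm x) := ofCoord_toCoord hφ hx _
  rw [randersCoord, randers, localRanders, randersDisc, lam, D.metricCoord_apply,
    D.metricCoord_apply, D.metricCoord_apply, hw]

theorem exists_symm_eq {φ : OpenPartialHomeomorph M V} {p : M} (hp : p ∈ φ.source) :
    ∃ x ∈ φ.target, φ.symm x = p :=
  ⟨φ p, φ.map_source hp, φ.left_inv hp⟩

theorem NavigationData.metricCoord_toCoord {φ : OpenPartialHomeomorph M V} (hφ : φ ∈ atlas V M)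
    {p : M} (hp : p ∈ φ.source) (u v : TangentSpace 𝓘(ℝ, V) p) :
    D.metricCoord φ (φ p) (toCoord φ p u) (toCoord φ p v) = D.metric.inner p u v := by
  obtain ⟨x, hx, rfl⟩ := exists_symm_eq hp
  rw [φ.right_inv hx, D.metricCoord_apply, ofCoord_toCoord hφ hx, ofCoord_toCoord hφ hx]

theorem NavigationData.windCoord_chart {φ : OpenPartialHomeomorph M V}
    {p : M} (hp : p ∈ φ.source) : D.windCoord φ (φ p) = toCoord φ p (D.wind p) := by
  obtain ⟨x, hx, rfl⟩ := exists_symm_eq hp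
  rw [φ.right_inv hx, windCoord]

theorem NavigationData.randersCoord_toCoord {φ : OpenPartialHomeomorph M V} (hφ : φ ∈ atlas V M)
    {p : M} (hp : p ∈ φ.source) (v : TangentSpace 𝓘(ℝ, V) p) :
    D.randersCoord φ (φ p) (toCoord φ p v) = D.randers p v := by
  obtain ⟨x, hx, rfl⟩ := exists_symm_eq hp
  rw [φ.right_inv hx, randersCoord, ofCoord_toCoord hφ hx]

section Transition

variable {φ ψ : OpenPartialHomeomorph M V} (hφ : φ ∈ atlas V M) (hψ : ψ ∈ atlas V M) {x : V}
  (hx : x ∈ φ.target) (hxψ : φ.symm x ∈ ψ.source)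
include hφ hψ hx hxψ

theorem contDiffAt_transition : ContDiffAt ℝ ∞ (ψ ∘ φ.symm) x := by
  have h1 := (contMDiffOn_symm hφ).contMDiffAt (φ.open_target.mem_nhds hx)
  have h2 := (contMDiffOn_chart' hψ).contMDiffAt (ψ.open_source.mem_nhds hxψ)
  exact (h2.comp x h1).contDiffAt

theorem fderiv_transition (u : V) :
    fderiv ℝ (ψ ∘ φ.symm) x u = toCoord ψ (φ.symm x) (ofCoord φ x u) := by
  have h1 := (contMDiffOn_symm hφ).contMDiffAt (φ.open_target.mem_nhds hx)
  have h2 := (contMDiffOn_chart' hψ).contMDiffAt (ψ.open_source.mem_nhds hxψ)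
  rw [← mfderiv_eq_fderiv, mfderiv_comp x (h2.mdifferentiableAt (by simp))
    (h1.mdifferentiableAt (by simp))]
  rfl

theorem fderiv_transition_surjective : Function.Surjective (fderiv ℝ (ψ ∘ φ.symm) x) := by
  intro z
  obtain ⟨z', hz', hp⟩ := exists_symm_eq hxψ
  have : ∀ p : M, ψ.symm z' = p → ∃ v : TangentSpace 𝓘(ℝ, V) p, toCoord ψ p v = z := by
    rintro p rfl
    exact ⟨_, toCoord_ofCoord hψ hz' z⟩
  obtain ⟨v, hv⟩ := this _ hp
  refine ⟨toCoord φ (φ.symm x) v, ?_⟩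
  rw [fderiv_transition hφ hψ hx hxψ, ofCoord_toCoord hφ hx, hv]

theorem eventually_transition : ∀ᶠ z in nhds x, z ∈ φ.target ∧ φ.symm z ∈ ψ.source := by
  filter_upwards [φ.open_target.mem_nhds hx,
    (φ.symm.continuousAt hx).eventually (ψ.open_source.mem_nhds hxψ)] with z h1 h2
  exact ⟨h1, h2⟩

theorem NavigationData.metricCoord_transition (u v : V) :
    D.metricCoord φ x u v = D.metricCoord ψ ((ψ ∘ φ.symm) x) (fderiv ℝ (ψ ∘ φ.symm) x u)
      (fderiv ℝ (ψ ∘ φ.symm) x v) := by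
  rw [fderiv_transition hφ hψ hx hxψ, fderiv_transition hφ hψ hx hxψ, Function.comp_apply,
    D.metricCoord_toCoord hψ hxψ, D.metricCoord_apply]

theorem NavigationData.windCoord_transition :
    D.windCoord ψ ((ψ ∘ φ.symm) x) = fderiv ℝ (ψ ∘ φ.symm) x (D.windCoord φ x) := by
  rw [fderiv_transition hφ hψ hx hxψ, Function.comp_apply, D.windCoord_chart hxψ, windCoord,
    ofCoord_toCoord hφ hx]

end Transition

end Chart

/-! ### Linear coordinates on the model space. -/

section Frame
set_option linter.unusedSectionVars false
set_option synthInstance.maxHeartbeats 200000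

variable {V : Type*} [NormedAddCommGroup V] [NormedSpace ℝ V] [FiniteDimensional ℝ V]

theorem comp_stdVec (i j : Ix V) : comp (stdVec i : V) j = if i = j then 1 else 0 := by
  simp [comp, stdVec, Finsupp.single_apply]

theorem vec_comp (y : V) : vec (comp y) = y :=
  (Module.finBasis ℝ V).sum_repr y

theorem comp_vec (a : Ix V → ℝ) (i : Ix V) : comp (vec a) i = a i := by
  have h := (Module.finBasis ℝ V).repr_sum_self a
  exact congrFun h i

theorem comp_injective {u v : V} (h : ∀ i, comp u i = comp v i) : u = v := by
  rw [← vec_comp u, ← vec_comp v, show comp u = comp v from funext h]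

/-- The coordinate functions as continuous linear maps. -/
def compL (i : Ix V) : V →L[ℝ] ℝ := LinearMap.toContinuousLinearMap ((Module.finBasis ℝ V).coord i)

theorem compL_apply (i : Ix V) (y : V) : compL i y = comp y i := rfl

theorem comp_add (u v : V) (i : Ix V) : comp (u + v) i = comp u i + comp v i :=
  map_add (compL i) u v

theorem comp_sub (u v : V) (i : Ix V) : comp (u - v) i = comp u i - comp v i :=
  map_sub (compL i) u v

theorem comp_smul (c : ℝ) (v : V) (i : Ix V) : comp (c • v) i = c * comp v i :=
  map_smul (compL i) c v

theorem comp_clm_apply (A : V →L[ℝ] V) (y : V) (k : Ix V) :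
    ∑ i, comp y i * comp (A (stdVec i)) k = comp (A y) k := by
  conv_rhs => rw [← vec_comp y]
  rw [vec, map_sum, ← compL_apply, map_sum]
  simp [compL_apply]

theorem trilinear_ext {f h : V → V → V → ℝ} (f₁ : ∀ v z, IsLinearMap ℝ fun u => f u v z)
    (f₂ : ∀ u z, IsLinearMap ℝ fun v => f u v z) (f₃ : ∀ u v, IsLinearMap ℝ fun z => f u v z)
    (h₁ : ∀ v z, IsLinearMap ℝ fun u => h u v z)
    (h₂ : ∀ u z, IsLinearMap ℝ fun v => h u v z) (h₃ : ∀ u v, IsLinearMap ℝ fun z => h u v z)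
    (hb : ∀ i j k : Ix V, f (stdVec i) (stdVec j) (stdVec k) = h (stdVec i) (stdVec j) (stdVec k))
    (u v z : V) : f u v z = h u v z := by
  have e : ∀ {p q : V → ℝ}, IsLinearMap ℝ p → IsLinearMap ℝ q →
      (∀ i : Ix V, p (stdVec i) = q (stdVec i)) → ∀ v, p v = q v := by
    intro p q hp hq hpq v
    exact congrArg (fun L => L v) ((Module.finBasis ℝ V).ext
      (f₁ := IsLinearMap.mk' p hp) (f₂ := IsLinearMap.mk' q hq) hpq)
  refine e (f₁ v z) (h₁ v z) (fun i => ?_) u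
  refine e (f₂ _ z) (h₂ _ z) (fun j => ?_) v
  exact e (f₃ _ _) (h₃ _ _) (fun k => hb i j k) z

theorem koszul_linear (T : V →L[ℝ] V →L[ℝ] V →L[ℝ] ℝ) :
    (∀ v z, IsLinearMap ℝ fun u => (1 / 2) * (T u v z + T v u z - T z u v)) ∧
    (∀ u z, IsLinearMap ℝ fun v => (1 / 2) * (T u v z + T v u z - T z u v)) ∧
    (∀ u v, IsLinearMap ℝ fun z => (1 / 2) * (T u v z + T v u z - T z u v)) := by
  have a₁ : ∀ a b v z, T (a + b) v z = T a v z + T b v z := fun a b v z => by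
    rw [map_add]; rfl
  have a₂ : ∀ a b v z, T v (a + b) z = T v a z + T v b z := fun a b v z => by
    rw [map_add]; rfl
  have a₃ : ∀ a b v z, T v z (a + b) = T v z a + T v z b := fun a b v z => map_add _ _ _
  have s₁ : ∀ (c : ℝ) a v z, T (c • a) v z = c * T a v z := fun c a v z => by
    rw [map_smul]; rfl
  have s₂ : ∀ (c : ℝ) a v z, T v (c • a) z = c * T v a z := fun c a v z => by
    rw [map_smul]; rfl
  have s₃ : ∀ (c : ℝ) a v z, T v z (c • a) = c * T v z a := fun c a v z => map_smul _ _ _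
  refine ⟨fun v z => ?_, fun v z => ?_, fun v z => ?_⟩ <;>
  exact ⟨fun a b => by simp only [a₁, a₂, a₃]; ring,
      fun c a => by simp only [s₁, s₂, s₃, smul_eq_mul]; ring⟩

/-- By Cramer's rule the entries of the inverse are determinants divided by the nonvanishing
determinant of `A`. -/
theorem contDiffAt_matrix_inv {E ι : Type*} [NormedAddCommGroup E] [NormedSpace ℝ E] [Fintype ι]
    [DecidableEq ι] {n : ℕ∞ω} {A : E → Matrix ι ι ℝ} {x : E}
    (hA : ∀ i j, ContDiffAt ℝ n (fun z => A z i j) x) (hdet : (A x).det ≠ 0) (i j : ι) :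
    ContDiffAt ℝ n (fun z => (A z)⁻¹ i j) x := by
  have hd : ∀ B : E → Matrix ι ι ℝ, (∀ i j, ContDiffAt ℝ n (fun z => B z i j) x) →
      ContDiffAt ℝ n (fun z => (B z).det) x := by
    intro B hB
    simp only [Matrix.det_apply']
    refine ContDiffAt.sum fun σ _ => ?_
    refine contDiffAt_const.mul ?_
    exact contDiffAt_prod fun i _ => hB _ _
  simp only [Matrix.inv_def, Ring.inverse_eq_inv', Matrix.smul_apply, smul_eq_mul,
    Matrix.adjugate_apply]
  refine ((hd A hA).inv hdet).mul (hd _ fun a b => ?_)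
  simp only [Matrix.updateRow_apply]
  split_ifs
  · exact contDiffAt_const
  · exact hA a b

end Frame

/-! ### Index expressions for the Christoffel symbols, `∇W` and the sprays in invariant form. -/

section Christoffel
set_option linter.unusedSectionVars false
set_option synthInstance.maxHeartbeats 200000

variable {V : Type*} [NormedAddCommGroup V] [NormedSpace ℝ V] [FiniteDimensional ℝ V]
  {M : Type*} [TopologicalSpace M] [ChartedSpace V M] [IsManifold 𝓘(ℝ, V) ∞ M]
  (D : NavigationData V M)

namespace NavigationData

/-- The Christoffel symbols as a vector valued bilinear map. -/
def christoffelVec (φ : OpenPartialHomeomorph M V) (x u v : V) : V :=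
  vec fun k => ∑ i, ∑ j, D.christoffel φ x k i j * comp u i * comp v j

variable {φ : OpenPartialHomeomorph M V} (hφ : φ ∈ atlas V M) {x : V} (hx : x ∈ φ.target)

theorem gram_eq (x : V) (i j : Ix V) :
    D.gram φ x i j = D.metricCoord φ x (stdVec i) (stdVec j) := rfl

theorem christoffelVec_linear_left (v : V) : IsLinearMap ℝ fun u => D.christoffelVec φ x u v := by
  constructor
  · intro a b
    apply comp_injective
    intro k
    simp only [christoffelVec, comp_vec, comp_add, ← Finset.sum_add_distrib]
    exact Finset.sum_congr rfl fun i _ => Finset.sum_congr rfl fun j _ => by ring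
  · intro c a
    apply comp_injective
    intro k
    simp only [christoffelVec, comp_vec, comp_smul, Finset.mul_sum]
    exact Finset.sum_congr rfl fun i _ => Finset.sum_congr rfl fun j _ => by ring

theorem christoffelVec_linear_right (u : V) : IsLinearMap ℝ fun v => D.christoffelVec φ x u v := by
  constructor
  · intro a b
    apply comp_injective
    intro k
    simp only [christoffelVec, comp_vec, comp_add, ← Finset.sum_add_distrib]
    exact Finset.sum_congr rfl fun i _ => Finset.sum_congr rfl fun j _ => by ring
  · intro c a
    apply comp_injective
    intro k
    simp only [christoffelVec, comp_vec, comp_smul, Finset.mul_sum]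
    exact Finset.sum_congr rfl fun i _ => Finset.sum_congr rfl fun j _ => by ring

theorem riemannSpray_eq (y : V) :
    D.riemannSpray φ x y = (1 / 2 : ℝ) • D.christoffelVec φ x y y := by
  apply comp_injective
  intro k
  simp only [riemannSpray, christoffelVec, comp_vec, comp_smul]

include hφ hx

theorem dGram_eq (l i j : Ix V) : D.dGram φ x l i j =
    fderiv ℝ (D.metricCoord φ) x (stdVec l) (stdVec i) (stdVec j) := by
  obtain ⟨L, h, e⟩ := hasFDerivAt_form_apply
    ((D.isLocalNavigation hφ).differentiableAt_metric hx).hasFDerivAt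
    (hasFDerivAt_const (stdVec i : V) x) (hasFDerivAt_const (stdVec j : V) x)
  have e := e (stdVec l)
  simp only [zero_apply, map_zero, add_zero] at e
  rw [← e, ← h.fderiv]
  rfl

theorem det_gram_ne_zero : (D.gram φ x).det ≠ 0 := by
  intro h
  obtain ⟨a, ha, h0⟩ := Matrix.exists_mulVec_eq_zero_iff.2 h
  have h1 : D.metricCoord φ x (vec a) (vec a) = 0 := by
    have : ∀ i, D.metricCoord φ x (stdVec i) (vec a) = 0 := by
      intro i
      have := congrFun h0 i
      simp only [Matrix.mulVec, dotProduct, gram_eq] at this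
      rw [vec, map_sum]
      simpa [mul_comm] using this
    conv_lhs => rw [show (vec a : V) = ∑ i, a i • stdVec i from rfl]
    rw [D.metricCoord_symm, map_sum]
    refine Finset.sum_eq_zero fun i _ => ?_
    rw [map_smul, D.metricCoord_symm]
    have := this i
    rw [vec] at this
    rw [this, smul_zero]
  refine ((D.isLocalNavigation hφ).pos x hx (vec a) fun h2 => ha ?_).ne' h1
  ext i
  rw [← comp_vec a i, h2, ← compL_apply, map_zero]
  rfl

/-- Both sides are trilinear, so basis vectors suffice; there, contraction with the Gram matrix
cancels its inverse in the Christoffel symbols. -/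
theorem isChristoffel : IsChristoffel (D.metricCoord φ) x (D.christoffelVec φ x) := by
  intro u v z
  refine trilinear_ext
    (f := fun u v z => D.metricCoord φ x (D.christoffelVec φ x u v) z)
    (h := fun u v z => (1 / 2) * (fderiv ℝ (D.metricCoord φ) x u v z
      + fderiv ℝ (D.metricCoord φ) x v u z - fderiv ℝ (D.metricCoord φ) x z u v))
    ?_ ?_ ?_ ?_ ?_ ?_ ?_ u v z
  · intro v z
    have := D.christoffelVec_linear_left (φ := φ) (x := x) v
    exact ⟨fun a b => by rw [this.map_add, map_add]; rfl,
      fun c a => by rw [this.map_smul, map_smul]; rfl⟩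
  · intro u z
    have := D.christoffelVec_linear_right (φ := φ) (x := x) u
    exact ⟨fun a b => by rw [this.map_add, map_add]; rfl,
      fun c a => by rw [this.map_smul, map_smul]; rfl⟩
  · exact fun u v => ⟨fun a b => map_add _ _ _, fun c a => map_smul _ _ _⟩
  · exact (koszul_linear _).1
  · exact (koszul_linear _).2.1
  · exact (koszul_linear _).2.2
  · intro i j m
    simp only [← D.dGram_eq hφ hx]
    have h1 : D.christoffelVec φ x (stdVec i) (stdVec j) = vec fun k => D.christoffel φ x k i j := by
      apply comp_injective
      intro k
      simp only [christoffelVec, comp_vec, comp_stdVec]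
      simp
    rw [h1, vec, map_sum, sum_apply]
    simp only [map_smul, smul_apply, smul_eq_mul, ← gram_eq, christoffel]
    have h2 : ∀ l, ∑ k, D.gram φ x k m * (D.gram φ x)⁻¹ k l = if m = l then 1 else 0 := by
      intro l
      have h3 := Matrix.mul_nonsing_inv (D.gram φ x) (D.det_gram_ne_zero hφ hx).isUnit
      have h4 := congrFun (congrFun h3 m) l
      rw [Matrix.mul_apply, Matrix.one_apply] at h4
      rw [← h4]
      refine Finset.sum_congr rfl fun k _ => ?_
      rw [gram_eq, gram_eq, D.metricCoord_symm]
    simp only [Finset.mul_sum, Finset.sum_mul]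
    rw [Finset.sum_comm]
    calc _ = ∑ l, (∑ k, D.gram φ x k m * (D.gram φ x)⁻¹ k l) *
          (1 / 2 * (D.dGram φ x i j l + D.dGram φ x j i l - D.dGram φ x l i j)) := by
          refine Finset.sum_congr rfl fun l _ => ?_
          rw [Finset.sum_mul]
          exact Finset.sum_congr rfl fun k _ => by ring
      _ = _ := by simp only [h2]; simp

theorem fderiv_comp_windCoord (u : V) (k : Ix V) :
    fderiv ℝ (fun z => comp (D.windCoord φ z) k) x u =
      comp (fderiv ℝ (D.windCoord φ) x u) k := by
  have h := (compL k).hasFDerivAt.comp x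
    ((D.isLocalNavigation hφ).differentiableAt_wind hx).hasFDerivAt
  exact congrArg (fun L => L u) h.fderiv

theorem covWind_eq (y : V) : D.covWind φ x y =
    fderiv ℝ (D.windCoord φ) x y + D.christoffelVec φ x y (D.windCoord φ x) := by
  apply comp_injective
  intro k
  simp only [covWind, christoffelVec, comp_vec, comp_add, D.fderiv_comp_windCoord hφ hx, mul_add,
    Finset.sum_add_distrib, comp_clm_apply, Finset.mul_sum]
  congr 1
  exact Finset.sum_congr rfl fun i _ => Finset.sum_congr rfl fun j _ => by ring

theorem naturalSpray_eq (y : V) : D.naturalSpray φ x y =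
    (1 / 2 : ℝ) • (D.christoffelVec φ x y y - D.randersCoord φ x y • D.covWind φ x y) := by
  rw [D.covWind_eq hφ hx]
  apply comp_injective
  intro k
  simp only [naturalSpray, christoffelVec, comp_vec, comp_add, comp_sub, comp_smul,
    D.fderiv_comp_windCoord hφ hx, comp_clm_apply]
  rw [show ∑ i, ∑ j, comp y i * D.christoffel φ x k i j * comp (D.windCoord φ x) j =
    ∑ i, ∑ j, D.christoffel φ x k i j * comp y i * comp (D.windCoord φ x) j from
    Finset.sum_congr rfl fun i _ => Finset.sum_congr rfl fun j _ => by ring]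
  ring

theorem contDiffAt_christoffel (k i j : Ix V) :
    ContDiffAt ℝ ∞ (fun z => D.christoffel φ z k i j) x := by
  have H := D.isLocalNavigation hφ
  have hg : ∀ i j, ContDiffAt ℝ ∞ (fun z => D.gram φ z i j) x := fun i j =>
    ((H.contDiffAt_metric hx).clm_apply contDiffAt_const).clm_apply contDiffAt_const
  have hdg : ∀ l i j, ContDiffAt ℝ ∞ (fun z => D.dGram φ z l i j) x := fun l i j =>
    ((hg i j).fderiv_right (m := ∞) (by simp)).clm_apply contDiffAt_const
  refine contDiffAt_const.mul (ContDiffAt.sum fun l _ => ?_)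
  exact (contDiffAt_matrix_inv hg (D.det_gram_ne_zero hφ hx) k l).mul
    (((hdg i j l).add (hdg j i l)).sub (hdg l i j))

theorem contDiffAt_christoffelVec {E : Type*} [NormedAddCommGroup E] [NormedSpace ℝ E]
    {a b c : E → V} {e : E} (hae : a e = x) (ha : ContDiffAt ℝ ∞ a e) (hb : ContDiffAt ℝ ∞ b e)
    (hc : ContDiffAt ℝ ∞ c e) :
    ContDiffAt ℝ ∞ (fun s => D.christoffelVec φ (a s) (b s) (c s)) e := by
  subst hae
  have h : ∀ k : Ix V, ContDiffAt ℝ ∞ (fun s => ∑ i, ∑ j,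
      D.christoffel φ (a s) k i j * comp (b s) i * comp (c s) j) e := by
    intro k
    refine ContDiffAt.sum fun i _ => ContDiffAt.sum fun j _ => ?_
    exact (((D.contDiffAt_christoffel hφ hx k i j).comp e ha).mul
      ((compL i).contDiff.contDiffAt.comp e hb)).mul ((compL j).contDiff.contDiffAt.comp e hc)
  simp only [christoffelVec, vec]
  exact ContDiffAt.sum fun k _ => (h k).smul contDiffAt_const

theorem contDiffAt_covWind {E : Type*} [NormedAddCommGroup E] [NormedSpace ℝ E]
    {a b : E → V} {e : E} (hae : a e = x) (ha : ContDiffAt ℝ ∞ a e) (hb : ContDiffAt ℝ ∞ b e) :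
    ContDiffAt ℝ ∞ (fun s => D.covWind φ (a s) (b s)) e := by
  subst hae
  have H := D.isLocalNavigation hφ
  have hw := H.contDiffAt_wind hx
  have hw' : ContDiffAt ℝ ∞ (fderiv ℝ (D.windCoord φ)) (a e) :=
    hw.fderiv_right (m := ∞) (by simp)
  have h1 := (hw'.comp e ha).clm_apply hb
  have h2 := D.contDiffAt_christoffelVec hφ hx rfl ha hb (hw.comp e ha)
  refine (h1.add h2).congr_of_eventuallyEq ?_
  filter_upwards [ha.continuousAt.eventually (φ.open_target.mem_nhds hx)] with s hs
  exact D.covWind_eq hφ hs _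

/-- This regularity feeds the existence theorem for natural geodesics. The zero vector is excluded
because `F` involves a norm-like square root. -/
theorem contDiffAt_naturalSpray {y : V} (hy : y ≠ 0) :
    ContDiffAt ℝ ∞ (fun q : V × V => D.naturalSpray φ q.1 q.2) (x, y) := by
  have H := D.isLocalNavigation hφ
  have h1 := D.contDiffAt_christoffelVec hφ hx (e := (x, y)) (a := Prod.fst) rfl contDiffAt_fst
    contDiffAt_snd contDiffAt_snd
  have h2 := D.contDiffAt_covWind hφ hx (e := (x, y)) (a := Prod.fst) rfl contDiffAt_fst
    contDiffAt_snd
  have h3 := H.contDiffAt_randers hx hy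
  have h4 := (contDiffAt_const (c := (1 / 2 : ℝ))).smul (h1.sub (h3.smul h2))
  refine h4.congr_of_eventuallyEq ?_
  filter_upwards [continuousAt_fst.eventually (φ.open_target.mem_nhds hx)] with q hq
  rw [D.naturalSpray_eq hφ hq, D.randersCoord_eq hφ hq]
  rfl

end NavigationData
end Christoffel

/-! ### Second order equations, regular curves in charts, covariant acceleration. -/

section Curves
set_option linter.unusedSectionVars false
set_option synthInstance.maxHeartbeats 200000

variable {V : Type*} [NormedAddCommGroup V] [NormedSpace ℝ V]

theorem two_le_infty : (2 : ℕ∞ω) ≤ ∞ := ENat.LEInfty.out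

theorem hasDerivAt_of_contDiffAt_two {x : ℝ → V} {t : ℝ} (hx : ContDiffAt ℝ 2 x t) :
    HasDerivAt x (deriv x t) t ∧ HasDerivAt (deriv x) (deriv (deriv x) t) t := by
  refine ⟨(hx.differentiableAt (by norm_num)).hasDerivAt, ?_⟩
  have h : ContDiffAt ℝ 1 (deriv x) t := hx.derivWithin (by norm_num)
  exact (h.differentiableAt (by norm_num)).hasDerivAt

theorem deriv_comp_transition {x z : ℝ → V} {T : V → V} {t : ℝ} (hx : ContDiffAt ℝ 2 x t)
    (hT : ContDiffAt ℝ 2 T (x t)) (h : z =ᶠ[nhds t] T ∘ x) :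
    deriv z t = fderiv ℝ T (x t) (deriv x t) ∧
    deriv (deriv z) t = fderiv ℝ (fderiv ℝ T) (x t) (deriv x t) (deriv x t)
      + fderiv ℝ T (x t) (deriv (deriv x) t) := by
  have h1 : deriv z =ᶠ[nhds t] fun s => fderiv ℝ T (x s) (deriv x s) := by
    filter_upwards [h.eventuallyEq_nhds, hx.eventually (by simp),
      hx.continuousAt.eventually (hT.eventually (by simp))] with s hs h2 h3
    rw [hs.deriv_eq]
    exact ((h3.differentiableAt (by norm_num)).hasFDerivAt.comp_hasDerivAt s
      (h2.differentiableAt (by norm_num)).hasDerivAt).deriv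
  refine ⟨h1.self_of_nhds, ?_⟩
  rw [h1.deriv_eq]
  have hT2 : DifferentiableAt ℝ (fderiv ℝ T) (x t) :=
    (hT.fderiv_right (m := 1) (by norm_num)).differentiableAt (by norm_num)
  obtain ⟨d1, d2⟩ := hasDerivAt_of_contDiffAt_two hx
  exact ((hT2.hasFDerivAt.comp_hasDerivAt t d1).clm_apply d2).deriv

/-- Local existence for second order equations. -/
theorem exists_second_order_solution {U : Set V} (hU : IsOpen U) {G : V → V → V}
    (hG : ∀ x ∈ U, ∀ y, y ≠ 0 → ContDiffAt ℝ 1 (fun q : V × V => G q.1 q.2) (x, y))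
    [CompleteSpace V] {x₀ y₀ : V} (hx₀ : x₀ ∈ U) (hy₀ : y₀ ≠ 0) :
    ∃ ε > (0 : ℝ), ∃ x v : ℝ → V, x 0 = x₀ ∧ v 0 = y₀ ∧ ∀ t ∈ Ioo (-ε) ε, x t ∈ U ∧ v t ≠ 0 ∧
      HasDerivAt x (v t) t ∧ HasDerivAt v (G (x t) (v t)) t := by
  -- The equation becomes a first order system on `V × V`; the interval of existence is then shrunk
  -- to keep the position in `U` and the velocity nonzero.
  have hf : ContDiffAt ℝ 1 (fun q : V × V => (q.2, G q.1 q.2)) (x₀, y₀) :=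
    contDiffAt_snd.prodMk (hG x₀ hx₀ y₀ hy₀)
  obtain ⟨α, h0, ε, hε, hα⟩ :=
    hf.exists_forall_mem_closedBall_exists_eq_forall_mem_Ioo_hasDerivAt₀ 0
  simp only [zero_sub, zero_add] at hα
  have hc : ContinuousAt α 0 := (hα 0 ⟨by linarith, hε⟩).continuousAt
  have hn : ∀ᶠ t in nhds 0, (α t).1 ∈ U ∧ (α t).2 ≠ 0 := by
    refine hc.eventually (p := fun q : V × V => q.1 ∈ U ∧ q.2 ≠ 0) ?_
    rw [h0]
    have ho : IsOpen {y : V | y ≠ 0} := isOpen_ne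
    exact (hU.prod ho).mem_nhds ⟨hx₀, hy₀⟩
  obtain ⟨δ, hδ, hδ'⟩ := Metric.eventually_nhds_iff.1 hn
  refine ⟨min ε δ, lt_min hε hδ, fun t => (α t).1, fun t => (α t).2, congrArg Prod.fst h0,
    congrArg Prod.snd h0,
    fun t ht => ?_⟩
  have h1 := hα t ⟨by linarith [ht.1, min_le_left ε δ], ht.2.trans_le (min_le_left _ _)⟩
  have h2 := hδ' (y := t) (by
    rw [Real.dist_eq, sub_zero, abs_lt]
    exact ⟨by linarith [ht.1, min_le_right ε δ], ht.2.trans_le (min_le_right _ _)⟩)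
  exact ⟨h2.1, h2.2, (hasFDerivAt_fst (𝕜 := ℝ) (p := α t)).comp_hasDerivAt t h1,
    (hasFDerivAt_snd (𝕜 := ℝ) (p := α t)).comp_hasDerivAt t h1⟩

variable [FiniteDimensional ℝ V]
  {M : Type*} [TopologicalSpace M] [ChartedSpace V M] [IsManifold 𝓘(ℝ, V) ∞ M]
  (D : NavigationData V M)

section Regular

variable {J : Set ℝ} {c : ℝ → M} (hc : IsRegularCurve V J c) {t : ℝ} (ht : t ∈ J)
  {φ : OpenPartialHomeomorph M V} (hφ : φ ∈ atlas V M) (hp : c t ∈ φ.source)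
include hc ht

theorem IsRegularCurve.contMDiffAt : ContMDiffAt 𝓘(ℝ, ℝ) 𝓘(ℝ, V) 2 c t :=
  hc.2.2.1.contMDiffAt (hc.1.mem_nhds ht)

include hφ hp

theorem IsRegularCurve.contDiffAt_chart : ContDiffAt ℝ 2 (φ ∘ c) t := by
  have h1 : ContMDiffAt 𝓘(ℝ, V) 𝓘(ℝ, V) 2 φ (c t) :=
    ((contMDiffOn_chart' hφ).contMDiffAt (φ.open_source.mem_nhds hp)).of_le two_le_infty
  exact (h1.comp t (hc.contMDiffAt ht)).contDiffAt

theorem IsRegularCurve.deriv_chart :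
    deriv (φ ∘ c) t = toCoord φ (c t) (mfderiv 𝓘(ℝ, ℝ) 𝓘(ℝ, V) c t 1) := by
  have h1 := (contMDiffOn_chart' hφ).contMDiffAt (φ.open_source.mem_nhds hp)
  have h2 := mfderiv_comp t (h1.mdifferentiableAt (by simp))
    ((hc.contMDiffAt ht).mdifferentiableAt (by norm_num))
  rw [← fderiv_apply_one_eq_deriv, ← mfderiv_eq_fderiv, h2]
  rfl

theorem IsRegularCurve.deriv_chart_ne_zero : deriv (φ ∘ c) t ≠ 0 := by
  rw [hc.deriv_chart ht hφ hp]
  intro h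
  refine hc.2.2.2 t ht ((mdifferentiable_of_mem_atlas (I := 𝓘(ℝ, V)) hφ).mfderiv_injective hp ?_)
  rw [map_zero]
  exact h

end Regular

namespace NavigationData

/-- The coordinate expression of the covariant acceleration of a curve. -/
def acceleration (φ : OpenPartialHomeomorph M V) (c : ℝ → M) (t : ℝ) : V :=
  deriv (deriv (φ ∘ c)) t
    + D.christoffelVec φ (φ (c t)) (deriv (φ ∘ c) t) (deriv (φ ∘ c) t)

variable {J : Set ℝ} {c : ℝ → M} (hc : IsRegularCurve V J c) {t : ℝ} (ht : t ∈ J)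
  {φ ψ : OpenPartialHomeomorph M V} (hφ : φ ∈ atlas V M) (hψ : ψ ∈ atlas V M)
  (hp : c t ∈ φ.source) (hpψ : c t ∈ ψ.source)

include hφ hψ in
theorem christoffelVec_transition {x : V} (hx : x ∈ φ.target) (hxψ : φ.symm x ∈ ψ.source)
    (u v : V) : fderiv ℝ (ψ ∘ φ.symm) x (D.christoffelVec φ x u v) =
      D.christoffelVec ψ ((ψ ∘ φ.symm) x) (fderiv ℝ (ψ ∘ φ.symm) x u)
        (fderiv ℝ (ψ ∘ φ.symm) x v) + fderiv ℝ (fderiv ℝ (ψ ∘ φ.symm)) x u v := by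
  have hT := contDiffAt_transition hφ hψ hx hxψ
  have hψx : (ψ ∘ φ.symm) x ∈ ψ.target := ψ.map_source hxψ
  refine (D.isChristoffel hφ hx).transition (D.isChristoffel hψ hψx)
    ((D.isLocalNavigation hψ).differentiableAt_metric hψx)
    (hT.of_le two_le_infty) ?_
    ((D.isLocalNavigation hφ).differentiableAt_metric hx) (D.metricCoord_symm ψ)
    ((D.isLocalNavigation hψ).pos _ hψx) (fderiv_transition_surjective hφ hψ hx hxψ) u v
  filter_upwards [eventually_transition hφ hψ hx hxψ] with z hz
  exact D.metricCoord_transition hφ hψ hz.1 hz.2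

include hφ hψ in
theorem covWind_transition {x : V} (hx : x ∈ φ.target) (hxψ : φ.symm x ∈ ψ.source) (u : V) :
    D.covWind ψ ((ψ ∘ φ.symm) x) (fderiv ℝ (ψ ∘ φ.symm) x u) =
      fderiv ℝ (ψ ∘ φ.symm) x (D.covWind φ x u) := by
  have hT := contDiffAt_transition hφ hψ hx hxψ
  have hψx : (ψ ∘ φ.symm) x ∈ ψ.target := ψ.map_source hxψ
  rw [D.covWind_eq hφ hx, D.covWind_eq hψ hψx]
  refine covariantDeriv_transition (D.christoffelVec_transition hφ hψ hx hxψ)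
    (hT.of_le two_le_infty)
    ((D.isLocalNavigation hφ).differentiableAt_wind hx)
    ((D.isLocalNavigation hψ).differentiableAt_wind hψx) ?_ u
  filter_upwards [eventually_transition hφ hψ hx hxψ] with z hz
  exact D.windCoord_transition hφ hψ hz.1 hz.2

include hc ht hφ hψ hp hpψ

/-- Velocity, covariant acceleration and `∇W` transform by the same Jacobian `A`, so the natural
geodesic equation holds in every chart once it holds in one. -/
theorem chart_transition : ∃ A : V →L[ℝ] V,
    deriv (ψ ∘ c) t = A (deriv (φ ∘ c) t) ∧
    D.acceleration ψ c t = A (D.acceleration φ c t) ∧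
    ∀ u, D.covWind ψ (ψ (c t)) (A u) = A (D.covWind φ (φ (c t)) u) := by
  have hx := φ.map_source hp
  have hxψ : φ.symm (φ (c t)) ∈ ψ.source := by rwa [φ.left_inv hp]
  have hT := contDiffAt_transition hφ hψ hx hxψ
  have hev : (ψ ∘ c) =ᶠ[nhds t] (ψ ∘ φ.symm) ∘ (φ ∘ c) := by
    filter_upwards [(hc.contMDiffAt ht).continuousAt.eventually (φ.open_source.mem_nhds hp)]
      with s hs
    simp only [Function.comp_apply]
    rw [φ.left_inv hs]
  obtain ⟨h1, h2⟩ := deriv_comp_transition (hc.contDiffAt_chart ht hφ hp)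
    (T := ψ ∘ φ.symm) (hT.of_le two_le_infty) hev
  have e : (ψ ∘ φ.symm) (φ (c t)) = ψ (c t) := by rw [Function.comp_apply, φ.left_inv hp]
  refine ⟨fderiv ℝ (ψ ∘ φ.symm) (φ (c t)), h1, ?_, fun u => ?_⟩
  · rw [acceleration, acceleration, map_add, D.christoffelVec_transition hφ hψ hx hxψ, h2, h1, e]
    simp only [Function.comp_apply]
    abel
  · rw [← e]
    exact D.covWind_transition hφ hψ hx hxψ u

omit hψ hpψ

theorem randersCoord_curve : D.randersCoord φ (φ (c t)) (deriv (φ ∘ c) t) =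
    D.randers (c t) (mfderiv 𝓘(ℝ, ℝ) 𝓘(ℝ, V) c t 1) := by
  rw [hc.deriv_chart ht hφ hp, D.randersCoord_toCoord hφ hp]

theorem hasDerivAt_riemannSpray_iff :
    HasDerivAt (deriv (φ ∘ c)) (-(2 : ℝ) • D.riemannSpray φ (φ (c t)) (deriv (φ ∘ c) t)) t ↔
      D.acceleration φ c t = 0 := by
  have h := (hasDerivAt_of_contDiffAt_two (hc.contDiffAt_chart ht hφ hp)).2
  rw [D.riemannSpray_eq, acceleration, smul_smul, add_eq_zero_iff_eq_neg]
  norm_num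
  exact ⟨fun h' => h.unique h', fun h' => h' ▸ h⟩

theorem hasDerivAt_naturalSpray_iff :
    HasDerivAt (deriv (φ ∘ c)) (-(2 : ℝ) • D.naturalSpray φ (φ (c t)) (deriv (φ ∘ c) t)) t ↔
      D.acceleration φ c t = D.randers (c t) (mfderiv 𝓘(ℝ, ℝ) 𝓘(ℝ, V) c t 1) •
        D.covWind φ (φ (c t)) (deriv (φ ∘ c) t) := by
  have h := (hasDerivAt_of_contDiffAt_two (hc.contDiffAt_chart ht hφ hp)).2
  rw [D.naturalSpray_eq hφ (φ.map_source hp), D.randersCoord_curve hc ht hφ hp, acceleration,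
    smul_smul, ← eq_sub_iff_add_eq]
  norm_num
  exact ⟨fun h' => h.unique h', fun h' => h' ▸ h⟩

end NavigationData
end Curves

/-! ### Reparametrizing a whole interval by a scalar second order equation. -/

section Reparametrization

theorem contDiffOn_one_of_hasDerivAt {V : Type*} [NormedAddCommGroup V] [NormedSpace ℝ V]
    {I : Set ℝ} (hI : IsOpen I) {x v : ℝ → V} (hx : ∀ t ∈ I, HasDerivAt x (v t) t)
    {n : ℕ} (hv : ContDiffOn ℝ n v I) : ContDiffOn ℝ (n + 1) x I := by
  rw [contDiffOn_succ_iff_deriv_of_isOpen hI]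
  refine ⟨fun t ht => (hx t ht).differentiableAt.differentiableWithinAt, by simp, ?_⟩
  exact hv.congr fun t ht => (hx t ht).deriv

theorem contDiffOn_two_of_hasDerivAt {V : Type*} [NormedAddCommGroup V] [NormedSpace ℝ V]
    {I : Set ℝ} (hI : IsOpen I) {x v a : ℝ → V} (hx : ∀ t ∈ I, HasDerivAt x (v t) t)
    (hv : ∀ t ∈ I, HasDerivAt v (a t) t) (ha : ContinuousOn a I) : ContDiffOn ℝ 2 x I := by
  have h0 : ContDiffOn ℝ (0 : ℕ) a I := by
    rw [Nat.cast_zero, contDiffOn_zero]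
    exact ha
  have h1 := contDiffOn_one_of_hasDerivAt hI hx (n := 1)
    (by simpa using contDiffOn_one_of_hasDerivAt hI hv h0)
  convert! h1 using 1

theorem exists_antiderivative {J : Set ℝ} (hJ : IsOpen J) (hJc : J.OrdConnected) {κ : ℝ → ℝ}
    (hκ : ContinuousOn κ J) : ∃ K : ℝ → ℝ, ∀ t ∈ J, HasDerivAt K (κ t) t := by
  rcases J.eq_empty_or_nonempty with rfl | ⟨t₀, ht₀⟩
  · exact ⟨0, fun t ht => ht.elim⟩
  · refine ⟨fun t => ∫ s in t₀..t, κ s, fun t ht => ?_⟩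
    exact intervalIntegral.integral_hasDerivAt_right
      ((hκ.mono (hJc.uIcc_subset ht₀ ht)).intervalIntegrable)
      (hκ.stronglyMeasurableAtFilter hJ t ht) (hκ.continuousAt (hJ.mem_nhds ht))

/-- `s` inverts the strictly increasing `u`; taking `u '' J` as its domain makes `s` cover all of
`J`. -/
theorem exists_inverse {J : Set ℝ} (hJ : IsOpen J) (hJc : J.OrdConnected) {u p : ℝ → ℝ}
    (hu : ∀ t ∈ J, HasDerivAt u (p t) t) (hp : ∀ t ∈ J, 0 < p t) :
    ∃ (J' : Set ℝ) (s : ℝ → ℝ), IsOpen J' ∧ J'.OrdConnected ∧ s '' J' = J ∧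
      ∀ r ∈ J', HasDerivAt s (p (s r))⁻¹ r := by
  have hcont : ContinuousOn u J := fun t ht => (hu t ht).continuousAt.continuousWithinAt
  have hmono : StrictMonoOn u J := by
    refine strictMonoOn_of_deriv_pos hJc.convex hcont fun t ht => ?_
    rw [hJ.interior_eq] at ht
    rw [(hu t ht).deriv]
    exact hp t ht
  have hopen : IsOpen (u '' J) := by
    rw [isOpen_iff_mem_nhds]
    rintro _ ⟨t, ht, rfl⟩
    obtain ⟨ε, hε, hb⟩ := Metric.isOpen_iff.1 hJ t ht
    have ha : t - ε / 2 ∈ J := hb (by rw [Real.ball_eq_Ioo]; constructor <;> linarith)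
    have hb : t + ε / 2 ∈ J := hb (by rw [Real.ball_eq_Ioo]; constructor <;> linarith)
    have hsub : Icc (t - ε / 2) (t + ε / 2) ⊆ J := hJc.out ha hb
    refine Filter.mem_of_superset (Icc_mem_nhds (hmono ha ht (by linarith))
      (hmono ht hb (by linarith))) ?_
    exact (intermediate_value_Icc (by linarith) (hcont.mono hsub)).trans (image_mono hsub)
  have hinv : ∀ t ∈ J, Function.invFunOn u J (u t) = t := fun t ht =>
    hmono.injOn.leftInvOn_invFunOn ht
  have himg : Function.invFunOn u J '' (u '' J) = J := by
    rw [image_image]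
    exact (image_congr hinv).trans (image_id J)
  refine ⟨u '' J, Function.invFunOn u J, hopen, ?_, himg, ?_⟩
  · exact ((hJc.isPreconnected).image u hcont).ordConnected
  · rintro _ ⟨t, ht, rfl⟩
    have hsm : MonotoneOn (Function.invFunOn u J) (u '' J) := by
      rintro _ ⟨a, ha, rfl⟩ _ ⟨b, hb, rfl⟩ hab
      rw [hinv a ha, hinv b hb]
      exact (hmono.le_iff_le ha hb).1 hab
    have hsc : ContinuousAt (Function.invFunOn u J) (u t) := by
      refine continuousAt_of_monotoneOn_of_image_mem_nhds hsm
        (hopen.mem_nhds (mem_image_of_mem u ht)) ?_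
      rw [himg, hinv t ht]
      exact hJ.mem_nhds ht
    have h1 : HasDerivAt u (p t) (Function.invFunOn u J (u t)) := by
      rw [hinv t ht]; exact hu t ht
    have h2 := HasDerivAt.of_local_left_inverse hsc h1 (hp t ht).ne' (by
      filter_upwards [hopen.mem_nhds (mem_image_of_mem u ht)]
      rintro _ ⟨a, ha, rfl⟩
      rw [hinv a ha])
    rwa [hinv t ht]

/-- Solution of `s'' = κ(s) s'²` which reparametrizes the whole interval `J`. -/
theorem exists_reparametrization {J : Set ℝ} (hJ : IsOpen J) (hJc : J.OrdConnected) {κ : ℝ → ℝ}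
    (hκ : ContinuousOn κ J) :
    ∃ (J' : Set ℝ) (s : ℝ → ℝ), IsOpen J' ∧ J'.OrdConnected ∧ ContDiffOn ℝ 2 s J' ∧
      (∀ t ∈ J', 0 < deriv s t) ∧ s '' J' = J ∧
      ∀ t ∈ J', deriv (deriv s) t = κ (s t) * deriv s t ^ 2 := by
  -- With `K' = κ` and `u' = exp(-K)`, the inverse `s` of `u` has `s' = exp(K ∘ s)`, hence `s'' =
  -- κ(s) s'²`. Quadratures replace an existence theorem and lose no part of the interval.
  obtain ⟨K, hK⟩ := exists_antiderivative hJ hJc hκ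
  have hpd : ∀ t ∈ J, HasDerivAt (fun t => Real.exp (-K t)) (Real.exp (-K t) * -κ t) t :=
    fun t ht => (hK t ht).neg.exp
  obtain ⟨u, hu⟩ := exists_antiderivative hJ hJc (κ := fun t => Real.exp (-K t))
    fun t ht => (hpd t ht).continuousAt.continuousWithinAt
  obtain ⟨J', s, h1, h2, h3, h4⟩ := exists_inverse hJ hJc hu fun t _ => Real.exp_pos _
  have hsJ : ∀ r ∈ J', s r ∈ J := fun r hr => h3 ▸ mem_image_of_mem s hr
  have h5 : ∀ r ∈ J', HasDerivAt (fun r => (Real.exp (-K (s r)))⁻¹)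
      (κ (s r) * ((Real.exp (-K (s r)))⁻¹) ^ 2) r := by
    intro r hr
    refine (((hpd _ (hsJ r hr)).comp r (h4 r hr)).inv (Real.exp_pos _).ne').congr_deriv ?_
    have := (Real.exp_pos (-K (s r))).ne'
    simp only [Function.comp_apply]
    field_simp
  have hd : ∀ r ∈ J', deriv s =ᶠ[nhds r] fun r => (Real.exp (-K (s r)))⁻¹ := by
    intro r hr
    filter_upwards [h1.mem_nhds hr] with z hz using (h4 z hz).deriv
  refine ⟨J', s, h1, h2, ?_, ?_, h3, ?_⟩
  · refine contDiffOn_two_of_hasDerivAt h1 h4 h5 ?_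
    have hs : ContinuousOn s J' := fun r hr => (h4 r hr).continuousAt.continuousWithinAt
    refine (hκ.comp hs hsJ).mul (ContinuousOn.pow ?_ 2)
    exact fun r hr => (h5 r hr).continuousAt.continuousWithinAt
  · intro r hr
    rw [(h4 r hr).deriv]
    exact inv_pos.2 (Real.exp_pos _)
  · intro r hr
    rw [(hd r hr).deriv_eq, (h5 r hr).deriv, (h4 r hr).deriv]

end Reparametrization

/-! ### The three families of geodesics in terms of the covariant acceleration and the local Randers
energy. -/

section Geodesics
set_option linter.unusedSectionVars false
set_option synthInstance.maxHeartbeats 200000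

variable {V : Type*} [NormedAddCommGroup V] [NormedSpace ℝ V] [FiniteDimensional ℝ V]
  {M : Type*} [TopologicalSpace M] [ChartedSpace V M] [IsManifold 𝓘(ℝ, V) ∞ M]
  (D : NavigationData V M)

namespace NavigationData

theorem isRiemannGeodesic_iff {J : Set ℝ} {c : ℝ → M} : D.IsRiemannGeodesic J c ↔
    IsRegularCurve V J c ∧ ∀ φ ∈ atlas V M, ∀ t ∈ J, c t ∈ φ.source →
      D.acceleration φ c t = 0 :=
  and_congr_right fun hc => forall₂_congr fun _ hφ => forall₂_congr fun _ ht =>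
    forall_congr' fun hp => D.hasDerivAt_riemannSpray_iff hc ht hφ hp

theorem isNaturalGeodesic_iff {J : Set ℝ} {c : ℝ → M} : D.IsNaturalGeodesic J c ↔
    IsRegularCurve V J c ∧ ∀ φ ∈ atlas V M, ∀ t ∈ J, c t ∈ φ.source →
      D.acceleration φ c t = D.randers (c t) (mfderiv 𝓘(ℝ, ℝ) 𝓘(ℝ, V) c t 1) •
        D.covWind φ (φ (c t)) (deriv (φ ∘ c) t) :=
  and_congr_right fun hc => forall₂_congr fun _ hφ => forall₂_congr fun _ ht =>
    forall_congr' fun hp => D.hasDerivAt_naturalSpray_iff hc ht hφ hp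

/-- The two energies agree only over the chart target, which is enough because derivatives depend on
germs. -/
theorem isRandersGeodesic_iff {J : Set ℝ} {c : ℝ → M} : D.IsRandersGeodesic J c ↔
    IsRegularCurve V J c ∧ ∀ φ ∈ atlas V M, ∀ t ∈ J, c t ∈ φ.source →
      HasDerivAt (fun s => fderiv ℝ (fun y => (1 / 2) *
          localRanders (D.metricCoord φ) (D.windCoord φ) ((φ ∘ c) s) y ^ 2) (deriv (φ ∘ c) s))
        (fderiv ℝ (fun x => (1 / 2) *
          localRanders (D.metricCoord φ) (D.windCoord φ) x (deriv (φ ∘ c) t) ^ 2)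
          ((φ ∘ c) t)) t := by
  refine and_congr_right fun hc => forall₂_congr fun φ hφ => forall₂_congr fun t ht =>
    forall_congr' fun hp => ?_
  have hx := φ.map_source hp
  have e1 : (fun x => (1 / 2) * D.randers (φ.symm x) (ofCoord φ x (deriv (φ ∘ c) t)) ^ 2)
      =ᶠ[nhds (φ (c t))] fun x => (1 / 2) *
          localRanders (D.metricCoord φ) (D.windCoord φ) x (deriv (φ ∘ c) t) ^ 2 := by
    filter_upwards [φ.open_target.mem_nhds hx] with z hz
    rw [← D.randersCoord_eq hφ hz, randersCoord]
  have e2 : (fun s => fderiv ℝ (fun y => (1 / 2) *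
      D.randers (φ.symm (φ (c s))) (ofCoord φ (φ (c s)) y) ^ 2) (deriv (φ ∘ c) s))
      =ᶠ[nhds t] (fun s => fderiv ℝ (fun y => (1 / 2) *
          localRanders (D.metricCoord φ) (D.windCoord φ) ((φ ∘ c) s) y ^ 2)
          (deriv (φ ∘ c) s)) := by
    filter_upwards [(hc.contMDiffAt ht).continuousAt.eventually (φ.open_source.mem_nhds hp)]
      with s hs
    congr 1
    funext y
    rw [Function.comp_apply, ← D.randersCoord_eq hφ (φ.map_source hs), randersCoord]
  simp only
  rw [e1.fderiv_eq]
  exact e2.hasDerivAt_iff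

theorem randers_smul {p : M} {k : ℝ} (hk : 0 < k) (v : TangentSpace 𝓘(ℝ, V) p) :
    D.randers p (k • v) = k * D.randers p v := by
  have h : D.metric.inner p (k • v) (D.wind p) = k * D.metric.inner p v (D.wind p) := by
    rw [map_smul]; rfl
  have h2 : D.metric.inner p (k • v) (k • v) = k * (k * D.metric.inner p v v) := by
    rw [map_smul, map_smul]; rfl
  unfold randers
  rw [h, h2, show (k * D.metric.inner p v (D.wind p)) ^ 2
    + D.lam p * (k * (k * D.metric.inner p v v)) =
    k ^ 2 * (D.metric.inner p v (D.wind p) ^ 2 + D.lam p * D.metric.inner p v v) by ring,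
    Real.sqrt_mul (by positivity), Real.sqrt_sq hk.le]
  ring

section Reparametrize

variable {J J' : Set ℝ} {c : ℝ → M} {s : ℝ → ℝ} (hc : IsRegularCurve V J c) (hJ' : IsOpen J')
  (hs : ContDiffOn ℝ 2 s J') (hpos : ∀ r ∈ J', 0 < deriv s r) (himg : s '' J' = J)
include hc hJ' hs hpos himg

theorem mfderiv_reparametrize {r : ℝ} (hr : r ∈ J') :
    mfderiv 𝓘(ℝ, ℝ) 𝓘(ℝ, V) (c ∘ s) r 1 =
      deriv s r • (mfderiv 𝓘(ℝ, ℝ) 𝓘(ℝ, V) c (s r) 1 : TangentSpace 𝓘(ℝ, V) (c (s r))) := by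
  have hsr : s r ∈ J := himg ▸ mem_image_of_mem s hr
  have h1 := (hs.contDiffAt (hJ'.mem_nhds hr)).differentiableAt (by norm_num)
  have h2 := mfderiv_comp r ((hc.contMDiffAt hsr).mdifferentiableAt (by norm_num))
    h1.mdifferentiableAt
  rw [h2, mfderiv_eq_fderiv]
  have h3 : fderiv ℝ s r 1 = deriv s r • (1 : ℝ) := by
    rw [fderiv_apply_one_eq_deriv, smul_eq_mul, mul_one]
  rw [← map_smul]
  exact congrArg (mfderiv 𝓘(ℝ, ℝ) 𝓘(ℝ, V) c (s r)) h3

theorem isRegularCurve_reparametrize (hJc : J'.OrdConnected) : IsRegularCurve V J' (c ∘ s) := by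
  refine ⟨hJ', hJc, ?_, fun r hr => ?_⟩
  · exact hc.2.2.1.comp hs.contMDiffOn fun r hr => himg ▸ mem_image_of_mem s hr
  · rw [mfderiv_reparametrize hc hJ' hs hpos himg hr]
    exact smul_ne_zero (hpos r hr).ne' (hc.2.2.2 _ (himg ▸ mem_image_of_mem s hr))

theorem acceleration_reparametrize {r : ℝ} (hr : r ∈ J') {φ : OpenPartialHomeomorph M V}
    (hφ : φ ∈ atlas V M) (hp : c (s r) ∈ φ.source) :
    deriv (φ ∘ (c ∘ s)) r = deriv s r • deriv (φ ∘ c) (s r) ∧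
    D.acceleration φ (c ∘ s) r = deriv (deriv s) r • deriv (φ ∘ c) (s r)
      + deriv s r ^ 2 • D.acceleration φ c (s r) := by
  have hsr : s r ∈ J := himg ▸ mem_image_of_mem s hr
  have hsc := hs.contDiffAt (hJ'.mem_nhds hr)
  obtain ⟨s1, s2⟩ := hasDerivAt_of_contDiffAt_two hsc
  have hx := hc.contDiffAt_chart hsr hφ hp
  obtain ⟨x1, x2⟩ := hasDerivAt_of_contDiffAt_two hx
  have e : deriv (φ ∘ (c ∘ s)) =ᶠ[nhds r] fun z => deriv s z • deriv (φ ∘ c) (s z) := by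
    filter_upwards [hsc.eventually (by simp), hsc.continuousAt.eventually
      (hx.eventually (by simp))] with z h1 h2
    exact ((h2.differentiableAt (by norm_num)).hasDerivAt.scomp z
      (h1.differentiableAt (by norm_num)).hasDerivAt).deriv
  refine ⟨e.self_of_nhds, ?_⟩
  have h1 : HasDerivAt (fun z => deriv (φ ∘ c) (s z)) _ r := x2.scomp r s1
  have h2 : HasDerivAt (fun z => deriv s z • deriv (φ ∘ c) (s z)) _ r := s2.smul h1
  have h3 : ∀ (k : ℝ) (a u : V), D.christoffelVec φ a (k • u) (k • u) =
      k • k • D.christoffelVec φ a u u := fun k a u =>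
    ((D.christoffelVec_linear_left _).map_smul k u).trans
      (congrArg (k • ·) ((D.christoffelVec_linear_right _).map_smul k u))
  rw [acceleration, acceleration, e.deriv_eq, e.self_of_nhds, h2.deriv, h3, Function.comp_apply]
  simp only [smul_smul, smul_add, sq]
  abel

end Reparametrize

/-- The spray equation is solved in the chart `φ`, and `chart_transition` gives it in the others.
Arbitrary initial velocities are what make the pointwise conclusions about `∇W` possible. -/
theorem exists_natural_geodesic {φ : OpenPartialHomeomorph M V} (hφ : φ ∈ atlas V M) {x y : V}
    (hx : x ∈ φ.target) (hy : y ≠ 0) :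
    ∃ (J : Set ℝ) (c : ℝ → M), D.IsNaturalGeodesic J c ∧ 0 ∈ J ∧ c 0 ∈ φ.source ∧
      φ (c 0) = x ∧ deriv (φ ∘ c) 0 = y := by
  obtain ⟨ε, hε, z, v, hz0, hv0, hzv⟩ := exists_second_order_solution φ.open_target
    (G := fun x y => -(2 : ℝ) • D.naturalSpray φ x y)
    (fun a ha b hb => (contDiffAt_const.smul (D.contDiffAt_naturalSpray hφ ha hb)).of_le
      ENat.LEInfty.out) hx hy
  have hJ : IsOpen (Ioo (-ε) ε) := isOpen_Ioo
  have h0 : (0 : ℝ) ∈ Ioo (-ε) ε := ⟨by linarith, hε⟩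
  have hev : ∀ t ∈ Ioo (-ε) ε, φ ∘ (φ.symm ∘ z) =ᶠ[nhds t] z := by
    intro t ht
    filter_upwards [hJ.mem_nhds ht] with r hr
    exact φ.right_inv (hzv r hr).1
  have hd : ∀ t ∈ Ioo (-ε) ε, deriv (φ ∘ (φ.symm ∘ z)) =ᶠ[nhds t] v := by
    intro t ht
    filter_upwards [hJ.mem_nhds ht] with r hr
    rw [(hev r hr).deriv_eq]
    exact (hzv r hr).2.2.1.deriv
  have hz2 : ContDiffOn ℝ 2 z (Ioo (-ε) ε) := by
    refine contDiffOn_two_of_hasDerivAt hJ (fun t ht => (hzv t ht).2.2.1)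
      (fun t ht => (hzv t ht).2.2.2) fun t ht => ?_
    obtain ⟨h1, h2, h3, h4⟩ := hzv t ht
    have h5 := (D.contDiffAt_naturalSpray hφ h1 h2).continuousAt.comp
      (f := fun t => (z t, v t)) (h3.continuousAt.prodMk h4.continuousAt)
    exact (h5.const_smul (-(2 : ℝ))).continuousWithinAt
  have hc : ContMDiffOn 𝓘(ℝ, ℝ) 𝓘(ℝ, V) 2 (φ.symm ∘ z) (Ioo (-ε) ε) :=
    ((contMDiffOn_symm hφ).of_le two_le_infty).comp hz2.contMDiffOn fun t ht => (hzv t ht).1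
  have hreg : IsRegularCurve V (Ioo (-ε) ε) (φ.symm ∘ z) := by
    refine ⟨hJ, ordConnected_Ioo, hc, fun t ht h => (hzv t ht).2.1 ?_⟩
    have h1 := (contMDiffOn_chart' hφ).contMDiffAt
      (φ.open_source.mem_nhds (φ.map_target (hzv t ht).1))
    have h2 := mfderiv_comp t (g := φ) (f := φ.symm ∘ z) (h1.mdifferentiableAt (by simp))
      ((hc.contMDiffAt (hJ.mem_nhds ht)).mdifferentiableAt (by norm_num))
    rw [← (hd t ht).self_of_nhds, ← fderiv_apply_one_eq_deriv, ← mfderiv_eq_fderiv, h2]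
    exact (congrArg (mfderiv 𝓘(ℝ, V) 𝓘(ℝ, V) φ ((φ.symm ∘ z) t)) h).trans (map_zero _)
  refine ⟨Ioo (-ε) ε, φ.symm ∘ z, D.isNaturalGeodesic_iff.2 ⟨hreg, ?_⟩, h0,
    φ.map_target (hzv 0 h0).1, ?_, ?_⟩
  · intro ψ hψ t ht hp
    have hpφ : (φ.symm ∘ z) t ∈ φ.source := φ.map_target (hzv t ht).1
    obtain ⟨A, hA1, hA2, hA3⟩ := D.chart_transition hreg ht hφ hψ hpφ hp
    have hzt : φ ((φ.symm ∘ z) t) = z t := (hev t ht).self_of_nhds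
    have h1 : HasDerivAt (deriv (φ ∘ (φ.symm ∘ z))) (-(2 : ℝ) •
        D.naturalSpray φ (φ ((φ.symm ∘ z) t)) (deriv (φ ∘ (φ.symm ∘ z)) t)) t := by
      rw [hzt, (hd t ht).self_of_nhds]
      exact (hzv t ht).2.2.2.congr_of_eventuallyEq (hd t ht)
    rw [D.hasDerivAt_naturalSpray_iff hreg ht hφ hpφ] at h1
    rw [hA2, h1, map_smul, hA1, hA3]
  · rw [← hz0]; exact (hev 0 h0).self_of_nhds
  · rw [← hv0]; exact (hd 0 h0).self_of_nhds

end NavigationData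
end Geodesics

/-! ### The global implications. -/

section Concircularity
set_option linter.unusedSectionVars false
set_option synthInstance.maxHeartbeats 200000

variable {V : Type*} [NormedAddCommGroup V] [NormedSpace ℝ V] [FiniteDimensional ℝ V]
  {M : Type*} [TopologicalSpace M] [ChartedSpace V M] [IsManifold 𝓘(ℝ, V) ∞ M]
  (D : NavigationData V M)

namespace NavigationData

/-- The covariant derivative of the wind as a linear map. -/
def covWindL (φ : OpenPartialHomeomorph M V) (x : V) : V →ₗ[ℝ] V :=
  (fderiv ℝ (D.windCoord φ) x : V →ₗ[ℝ] V)
    + IsLinearMap.mk' _ (D.christoffelVec_linear_left (φ := φ) (x := x) (D.windCoord φ x))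

theorem covWindL_apply {φ : OpenPartialHomeomorph M V} (hφ : φ ∈ atlas V M) {x : V}
    (hx : x ∈ φ.target) (y : V) : D.covWindL φ x y = D.covWind φ x y := by
  rw [D.covWind_eq hφ hx]
  rfl

/-- Pointwise criterion for a wind to be concircular. -/
theorem isConcircular_of_forall (h : ∀ φ ∈ atlas V M, ∀ x ∈ φ.target, ∀ y : V,
    ∃ k : ℝ, D.covWind φ x y = k • y) : D.IsConcircular := by
  have h1 : ∀ φ ∈ atlas V M, ∀ x ∈ φ.target, ∃ k : ℝ, ∀ y, D.covWind φ x y = k • y := by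
    intro φ hφ x hx
    obtain ⟨k, hk⟩ := exists_smul_of_forall_exists_smul (D.covWindL φ x) fun y => by
      rw [D.covWindL_apply hφ hx]; exact h φ hφ x hx y
    exact ⟨k, fun y => by rw [← D.covWindL_apply hφ hx, hk]⟩
  -- `f` is defined through the preferred chart at each point; `covWind_transition` shows that any
  -- other chart gives the same factor.
  choose f hf using fun p : M => h1 (chartAt V p) (chart_mem_atlas V p) (chartAt V p p)
    (mem_chart_target V p)
  have h2 : ∀ φ ∈ atlas V M, ∀ x ∈ φ.target, ∀ y : V,
      D.covWind φ x y = f (φ.symm x) • y := by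
    intro φ hφ x hx y
    obtain ⟨k, hk⟩ := h1 φ hφ x hx
    rw [hk]
    by_cases hy : y = 0
    · rw [hy, smul_zero, smul_zero]
    have hψ := chart_mem_atlas V (φ.symm x)
    have hxψ := mem_chart_source V (φ.symm x)
    have e := D.covWind_transition hφ hψ hx hxψ y
    rw [hk, map_smul, Function.comp_apply, hf] at e
    have hne : fderiv ℝ (chartAt V (φ.symm x) ∘ φ.symm) x y ≠ 0 := by
      intro h0
      have h3 := D.metricCoord_transition hφ hψ hx hxψ y y
      rw [h0, map_zero] at h3
      exact ((D.isLocalNavigation hφ).pos x hx y hy).ne' h3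
    rw [smul_left_injective ℝ hne e]
  refine ⟨f, fun p => ?_, h2⟩
  have hφ := chart_mem_atlas V p
  have hp := mem_chart_source V p
  -- Near `p`, `f` is `⟨∇_e W, e⟩ / ⟨e, e⟩` for a fixed `e ≠ 0`, hence smooth. If `V` is zero, the
  -- chart domain is a single point.
  obtain ⟨q, hq, hfq⟩ : ∃ q : V → ℝ, ContDiffAt ℝ ∞ q (chartAt V p p) ∧
      f =ᶠ[nhds p] q ∘ chartAt V p := by
    by_cases hV : ∃ e : V, e ≠ 0
    · obtain ⟨e, he⟩ := hV
      have hx := mem_chart_target V p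
      have H := D.isLocalNavigation hφ
      have hg := H.contDiffAt_metric hx
      refine ⟨fun x => D.metricCoord (chartAt V p) x (D.covWind (chartAt V p) x e) e /
        D.metricCoord (chartAt V p) x e e, ?_, ?_⟩
      · exact ((hg.clm_apply (D.contDiffAt_covWind hφ hx (a := id) (b := fun _ => e) rfl
          contDiffAt_id contDiffAt_const)).clm_apply contDiffAt_const).div
          ((hg.clm_apply contDiffAt_const).clm_apply contDiffAt_const) (H.pos _ hx e he).ne'
      · filter_upwards [(chartAt V p).open_source.mem_nhds hp] with r hr
        have hr' := (chartAt V p).map_source hr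
        have hpos := (H.pos _ hr' e he).ne'
        rw [Function.comp_apply, h2 _ hφ _ hr', (chartAt V p).left_inv hr, map_smul, smul_apply,
          smul_eq_mul]
        field_simp
    · push Not at hV
      refine ⟨fun _ => f p, contDiffAt_const, ?_⟩
      filter_upwards [(chartAt V p).open_source.mem_nhds hp] with r hr
      rw [(chartAt V p).injOn hr hp ((hV _).trans (hV _).symm)]
      rfl
  refine ContMDiffAt.congr_of_eventuallyEq ?_ hfq
  exact hq.contMDiffAt.comp p ((contMDiffOn_chart' hφ).contMDiffAt
    ((chartAt V p).open_source.mem_nhds hp))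

theorem isConcircular_of_sameGeodesics
    (h : SameGeodesics D.IsNaturalGeodesic D.IsRandersGeodesic) : D.IsConcircular := by
  refine D.isConcircular_of_forall fun φ hφ x hx => ?_
  have H := D.isLocalNavigation hφ
  refine exists_smul_of_forall_exists_form (H.pos x hx) fun n hn => ?_
  have hnn := H.pos x hx n hn
  have hW := H.lt_one x hx
  set W := D.windCoord φ x with hWd
  set a := √(D.metricCoord φ x n n) with ha
  have ha0 : 0 < a := Real.sqrt_pos.2 hnn
  have ha2 : a ^ 2 = D.metricCoord φ x n n := Real.sq_sqrt hnn.le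
  -- The velocity `y = n + ‖n‖W` has `F(y) = ‖n‖` and so `y - F(y)W = n`; it is nonzero because `‖W‖
  -- < 1`.
  have hy : n + a • W ≠ 0 := by
    intro h0
    have h1 : n = -(a • W) := eq_neg_of_add_eq_zero_left h0
    have h2 : D.metricCoord φ x n n = a ^ 2 * D.metricCoord φ x W W := by
      rw [h1]
      simp only [map_neg, map_smul, neg_apply, smul_apply, smul_eq_mul]
      ring
    nlinarith
  have hF : localRanders (D.metricCoord φ) (D.windCoord φ) x (n + a • W) = a := by
    refine H.randers_eq_of_quadratic hx hy ha0 ?_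
    rw [← hWd]
    simp only [map_add, map_smul, add_apply, smul_apply, smul_eq_mul]
    rw [D.metricCoord_symm φ x W n]
    linear_combination ha2
  obtain ⟨J, c, hc, h0, hp, hcx, hcy⟩ := D.exists_natural_geodesic hφ hx hy
  have hr := (D.isRandersGeodesic_iff.1 ((h J c).1 hc)).2 φ hφ 0 h0 hp
  obtain ⟨hreg, hn⟩ := D.isNaturalGeodesic_iff.1 hc
  have hn := hn φ hφ 0 h0 hp
  rw [← D.randersCoord_curve hreg h0 hφ hp, hcx, hcy, D.randersCoord_eq hφ hx, acceleration,
    hcx, hcy, D.covWind_eq hφ hx] at hn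
  obtain ⟨d1, d2⟩ := hasDerivAt_of_contDiffAt_two (hreg.contDiffAt_chart h0 hφ hp)
  have hcx' : (φ ∘ c) 0 = x := hcx
  obtain ⟨k, hk⟩ := H.exists_eigen_of_euler_lagrange (c := φ ∘ c) (v := deriv (φ ∘ c)) (t := 0)
    (by rw [hcx']; exact hx) (by rw [hcy]; exact hy) d1 d2
    (Γ := D.christoffelVec φ x) (by rw [hcx']; exact D.isChristoffel hφ hx)
    (by rw [hcx', hcy]; exact hn) hr
  refine ⟨k, fun v => ?_⟩
  have := hk v
  rwa [hcx', hcy, hF, add_sub_cancel_right, ← D.covWind_eq hφ hx] at this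

/-- One direction of the equivalence suffices: a reparametrized natural geodesic has acceleration
`s'' ċ + s'² F ∇_ċ W`, and its vanishing makes `∇_ċ W` a multiple of `ċ` since `s'² F > 0`. -/
theorem isConcircular_of_projectivelyEquivalent
    (h : ReparametrizesInto D.IsNaturalGeodesic D.IsRiemannGeodesic) : D.IsConcircular := by
  refine D.isConcircular_of_forall fun φ hφ x hx y => ?_
  by_cases hy : y = 0
  · refine ⟨0, ?_⟩
    rw [hy, ← D.covWindL_apply hφ hx, map_zero, smul_zero]
  obtain ⟨J, c, hc, h0, hp, hcx, hcy⟩ := D.exists_natural_geodesic hφ hx hy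
  obtain ⟨J', s, hJ', -, hs, hpos, himg, hR⟩ := h J c hc
  obtain ⟨hreg, hn⟩ := D.isNaturalGeodesic_iff.1 hc
  obtain ⟨r, hr, hr0⟩ : (0 : ℝ) ∈ s '' J' := himg ▸ h0
  have hpr : c (s r) ∈ φ.source := by rw [hr0]; exact hp
  have h1 := (D.isRiemannGeodesic_iff.1 hR).2 φ hφ r hr hpr
  rw [(D.acceleration_reparametrize hreg hJ' hs hpos himg hr hφ hpr).2, hr0, hn φ hφ 0 h0 hp,
    ← D.randersCoord_curve hreg h0 hφ hp, hcx, hcy, D.randersCoord_eq hφ hx] at h1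
  have hF := (D.isLocalNavigation hφ).randers_pos hx hy
  have hs' := hpos r hr
  rw [smul_smul, add_comm, add_eq_zero_iff_eq_neg] at h1
  refine ⟨(deriv s r ^ 2 * localRanders (D.metricCoord φ) (D.windCoord φ) x y)⁻¹ *
    -deriv (deriv s) r, ?_⟩
  rw [mul_smul, neg_smul, ← h1, smul_smul, inv_mul_cancel₀ (by positivity), one_smul]

theorem sameGeodesics_of_isConcircular (h : D.IsConcircular) :
    SameGeodesics D.IsNaturalGeodesic D.IsRandersGeodesic := by
  obtain ⟨f, -, hf⟩ := h
  intro J c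
  rw [D.isNaturalGeodesic_iff, D.isRandersGeodesic_iff]
  refine and_congr_right fun hc => forall₂_congr fun φ hφ => forall₂_congr fun t ht =>
    forall_congr' fun hp => ?_
  have hx := φ.map_source hp
  obtain ⟨d1, d2⟩ := hasDerivAt_of_contDiffAt_two (hc.contDiffAt_chart ht hφ hp)
  rw [(D.isLocalNavigation hφ).euler_lagrange_iff_of_concircular (c := φ ∘ c)
    (v := deriv (φ ∘ c)) hx (hc.deriv_chart_ne_zero ht hφ hp) d1 d2 (D.isChristoffel hφ hx)
    (k := f (c t)) fun u => ?_, ← D.randersCoord_curve hc ht hφ hp, hf φ hφ _ hx, φ.left_inv hp,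
    smul_smul, D.randersCoord_eq hφ hx]
  · rfl
  · rw [Function.comp_apply, ← D.covWind_eq hφ hx, hf φ hφ _ hx, φ.left_inv hp]

theorem continuousOn_randers {J : Set ℝ} {c : ℝ → M} (hc : IsRegularCurve V J c) :
    ContinuousOn (fun t => D.randers (c t) (mfderiv 𝓘(ℝ, ℝ) 𝓘(ℝ, V) c t 1)) J := by
  intro t ht
  have hφ := chart_mem_atlas V (c t)
  have hp := mem_chart_source V (c t)
  have hx := mem_chart_target V (c t)
  obtain ⟨d1, d2⟩ := hasDerivAt_of_contDiffAt_two (hc.contDiffAt_chart ht hφ hp)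
  have h1 := ((D.isLocalNavigation hφ).contDiffAt_randers hx
    (hc.deriv_chart_ne_zero ht hφ hp)).continuousAt.comp
    (f := fun s => ((chartAt V (c t) ∘ c) s, deriv (chartAt V (c t) ∘ c) s))
    (d1.continuousAt.prodMk d2.continuousAt)
  refine (h1.congr_of_eventuallyEq ?_).continuousWithinAt
  filter_upwards [hc.1.mem_nhds ht, (hc.contMDiffAt ht).continuousAt.eventually
    ((chartAt V (c t)).open_source.mem_nhds hp)] with s hs hps
  rw [← D.randersCoord_curve hc hs hφ hps, D.randersCoord_eq hφ ((chartAt V (c t)).map_source hps)]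
  rfl

theorem projectivelyEquivalent_of_isConcircular (h : D.IsConcircular) :
    ProjectivelyEquivalent D.IsNaturalGeodesic D.IsRiemannGeodesic := by
  obtain ⟨f, hfs, hf⟩ := h
  have hκ : ∀ {J : Set ℝ} {c : ℝ → M}, IsRegularCurve V J c → ContinuousOn (fun t =>
      D.randers (c t) (mfderiv 𝓘(ℝ, ℝ) 𝓘(ℝ, V) c t 1) * f (c t)) J := fun hc =>
    (D.continuousOn_randers hc).mul (hfs.continuous.comp_continuousOn hc.2.2.1.continuousOn)
  constructor
  · intro J c hc
    obtain ⟨hreg, hn⟩ := D.isNaturalGeodesic_iff.1 hc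
    obtain ⟨J', s, hJ', hJc, hs, hpos, himg, hss⟩ :=
      -- The sign makes `s'' ċ` cancel the acceleration `s'² F f ċ` of the natural geodesic.
      exists_reparametrization hreg.1 hreg.2.1 (hκ hreg).neg
    refine ⟨J', s, hJ', hJc, hs, hpos, himg, D.isRiemannGeodesic_iff.2
      ⟨isRegularCurve_reparametrize hreg hJ' hs hpos himg hJc, fun φ hφ r hr hp => ?_⟩⟩
    have hsr : s r ∈ J := himg ▸ mem_image_of_mem s hr
    have hp' : c (s r) ∈ φ.source := hp
    rw [(D.acceleration_reparametrize hreg hJ' hs hpos himg hr hφ hp').2, hn φ hφ _ hsr hp',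
      hss r hr, hf φ hφ _ (φ.map_source hp'), φ.left_inv hp']
    simp only [smul_smul, ← add_smul, Pi.neg_apply]
    rw [smul_eq_zero]
    exact Or.inl (by ring)
  · intro J c hc
    obtain ⟨hreg, hn⟩ := D.isRiemannGeodesic_iff.1 hc
    obtain ⟨J', s, hJ', hJc, hs, hpos, himg, hss⟩ :=
      -- Here `s'' ċ` is the whole acceleration; it matches `F(s' ċ) f s' ċ` by positive homogeneity
      -- of `F`.
      exists_reparametrization hreg.1 hreg.2.1 (hκ hreg)
    refine ⟨J', s, hJ', hJc, hs, hpos, himg, D.isNaturalGeodesic_iff.2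
      ⟨isRegularCurve_reparametrize hreg hJ' hs hpos himg hJc, fun φ hφ r hr hp => ?_⟩⟩
    have hsr : s r ∈ J := himg ▸ mem_image_of_mem s hr
    have hp' : c (s r) ∈ φ.source := hp
    obtain ⟨e1, e2⟩ := D.acceleration_reparametrize hreg hJ' hs hpos himg hr hφ hp'
    rw [Function.comp_apply, e1, e2, hn φ hφ _ hsr hp', hss r hr, hf φ hφ _ (φ.map_source hp'),
      mfderiv_reparametrize hreg hJ' hs hpos himg hr, φ.left_inv hp', smul_zero, add_zero,
      D.randers_smul (hpos r hr), smul_smul, smul_smul]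
    congr 1
    ring

end NavigationData
end Concircularity

end ZermeloNavigation

end

theorem mainTheorem7 {V : Type*} [NormedAddCommGroup V] [NormedSpace ℝ V] [FiniteDimensional ℝ V]
    {M : Type*} [TopologicalSpace M] [T2Space M] [SecondCountableTopology M] [ConnectedSpace M]
    [ChartedSpace V M] [IsManifold 𝓘(ℝ, V) ∞ M]
    (D : ZermeloNavigation.NavigationData V M) :
    List.TFAE
      [ZermeloNavigation.SameGeodesics D.IsNaturalGeodesic D.IsRandersGeodesic,
       ZermeloNavigation.ProjectivelyEquivalent D.IsNaturalGeodesic D.IsRiemannGeodesic,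
       ZermeloNavigation.ProjectivelyEquivalent D.IsNaturalGeodesic D.IsRiemannGeodesic ∧
         ZermeloNavigation.ProjectivelyEquivalent D.IsRandersGeodesic D.IsRiemannGeodesic,
       D.IsConcircular] := by
  tfae_have 1 → 4 := D.isConcircular_of_sameGeodesics
  tfae_have 4 → 1 := D.sameGeodesics_of_isConcircular
  tfae_have 3 → 2 := And.left
  tfae_have 2 → 4 := fun h => D.isConcircular_of_projectivelyEquivalent h.1
  tfae_have 4 → 3 := by
    intro h
    have h1 := D.projectivelyEquivalent_of_isConcircular h
    -- As the two families are equal, the second equivalence of item 3 is the first one.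
    have h2 : D.IsRandersGeodesic = D.IsNaturalGeodesic := by
      funext J c
      exact propext (D.sameGeodesics_of_isConcircular h J c).symm
    exact ⟨h1, h2 ▸ h1⟩
  tfae_finish
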